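/- Let $c,d\ge 1$ be integers, let $G=\langle a,b : ab^c=b^da\rangle$ be the Baumslag–Solitar group, let $P\subseteq G$ be the submonoid generated by $a$ and $b$, and let $\theta:G\to\mathbb Z$ be the homomorphism with $\theta(a)=1$, $\theta(b)=0$. Order $G$ by $g\le h\iff g^{-1}h\in P$, and write $x\vee y$ for the least upper bound of $x,y$ in $P$ if they have a common upper bound in $P$, and $x\vee y=\infty$ otherwise. Let $C^*(G,P)$ be the universal unital $C^*$-algebra generated by a Nica-covariant representation $T$ of $P$, that is, by isometries $T_x$ ($x\in P$) with $T_e=1$, $T_xT_y=T_{xy}$, and $T_xT_x^*T_yT_y^*=T_{x\vee y}T_{x\vee y}^*$ if $x\vee y<\infty$, $T_xT_x^*T_yT_y^*=0$ if $x\vee y=\infty$. Let $\alpha:\mathbb R\to\operatorname{Aut}C^*(G,P)$ be the action with $\alpha_t(T_x)=e^{it\theta(x)}T_x$. Let $\mathcal O(G,P)=C^*(G,P)/I$, where $I$ is the closed two-sided ideal generated by $1-\sum_{j=0}^{d-1}T_{b^ja}T_{b^ja}^*$, write $q$ for the quotient map, $\bar T_x=q(T_x)$, and write $\alpha$ also for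 the induced action on $\mathcal O(G,P)$. For $\beta\in\mathbb R$, a KMS$_\beta$ state is a state $\phi$ with $\phi(uv)=\phi(v\,\alpha_{i\beta}(u))$ for all analytic $u$ and all $v$. For $\beta>\ln d$ and a probability measure $\mu$ on the circle $\mathbb T$, let $\psi_{\beta,\mu}$ denote the KMS$_\beta$ state of $(C^*(G,P),\alpha)$ such that for all $t\in\mathbb N$ \[ \psi_{\beta,\mu}(T_{b^t})=(1-e^{-\beta}d)\Big(\int_{\mathbb T} z^t\,d\mu(z)+\sum_{k}e^{-\beta k}d^k\int_{\mathbb T} z^{c^kd^{-k}t}\,d\mu(z)\Big), \] the sum being over those $k\ge 1$ such that $d$ divides the integer $c^jd^{-j}t$ for all $0\le j<k$. Then there is a KMS$_{\ln d}$ state $\psi$ of $(\mathcal O(G,P),\alpha)$ such that \[ \psi(\bar T_x\bar T_y^*)=\delta_{x,y}\,e^{-(\ln d)\theta(x)}\qquad\text{for all }x,y\in P . \] For every $\beta>\ln d$ the state $\psi_{\beta,\mathrm{Haar}}$ ($\mu$ the normalized Haar measure on $\mathbb T$) exists and is unique, and for every sequence $\beta_n>\ln d$ with $\beta_n\to\ln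 d$ (in particular for every sequence decreasing to $\ln d$) the states $\psi_{\beta_n,\mathrm{Haar}}$ converge weak* to $\psi\circ q$. If $d$ does not divide $c$, then $\psi$ is the only KMS state of $(\mathcal O(G,P),\alpha)$: if $\phi$ is a KMS$_\beta$ state of $(\mathcal O(G,P),\alpha)$ for some $\beta\in\mathbb R$, then $\beta=\ln d$ and $\phi=\psi$. -/

import Mathlib

open scoped ENNReal ComplexOrder
open MeasureTheory

noncomputable section

namespace QuotientCStar

variable {A : Type*} [CStarAlgebra A]

/-- For `y` and `δ > 0` put `h = y⋆y`; then `k = δ (h + δ)⁻¹` is a self-adjoint contraction,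
`1 - k` is a multiple of `h`, and `y k` is small. -/
theorem exists_cutoff (y : A) {δ : ℝ} (hδ : 0 < δ) :
    ∃ k r : A, star k = k ∧ ‖k‖ ≤ 1 ∧ 1 - k = star y * y * r ∧ ‖y * k‖ * ‖y * k‖ ≤ δ := by
  set h : A := star y * y with hh
  have hsa : IsSelfAdjoint h := IsSelfAdjoint.star_mul_self y
  let _ : PartialOrder A := CStarAlgebra.spectralOrder A
  have _ : StarOrderedRing A := CStarAlgebra.spectralOrderedRing A
  have hpos : ∀ x ∈ spectrum ℝ h, 0 ≤ x := fun x hx =>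
    spectrum_nonneg_of_nonneg (star_mul_self_nonneg y) hx
  have hne : ∀ x ∈ spectrum ℝ h, x + δ ≠ 0 := fun x hx => by
    have := hpos x hx; positivity
  have hc1 : ContinuousOn (fun x : ℝ => δ / (x + δ)) (spectrum ℝ h) :=
    continuousOn_const.div (by fun_prop) hne
  have hc2 : ContinuousOn (fun x : ℝ => 1 / (x + δ)) (spectrum ℝ h) :=
    continuousOn_const.div (by fun_prop) hne
  have hk : star (cfc (fun x : ℝ => δ / (x + δ)) h) = cfc (fun x : ℝ => δ / (x + δ)) h :=
    (cfc_predicate (R := ℝ) (fun x : ℝ => δ / (x + δ)) h : IsSelfAdjoint _)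
  refine ⟨cfc (fun x : ℝ => δ / (x + δ)) h, cfc (fun x : ℝ => 1 / (x + δ)) h, hk, ?_, ?_, ?_⟩
  · refine norm_cfc_le zero_le_one fun x hx => ?_
    have := hpos x hx
    rw [Real.norm_of_nonneg (by positivity), div_le_one (by positivity)]
    linarith
  · have e1 : (1 : A) = cfc (fun _ : ℝ => (1 : ℝ)) h := (cfc_const_one ℝ h).symm
    have e2 : h = cfc (fun x : ℝ => x) h := (cfc_id' ℝ h).symm
    calc (1 : A) - cfc (fun x : ℝ => δ / (x + δ)) h
        = cfc (fun x : ℝ => 1 - δ / (x + δ)) h := by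
          rw [cfc_sub (fun _ : ℝ => (1 : ℝ)) (fun x : ℝ => δ / (x + δ)) h (by fun_prop) hc1, ← e1]
      _ = cfc (fun x : ℝ => x * (1 / (x + δ))) h := by
          refine cfc_congr fun x hx => ?_
          have := hne x hx
          field_simp
          ring
      _ = h * cfc (fun x : ℝ => 1 / (x + δ)) h := by
          rw [cfc_mul (fun x : ℝ => x) (fun x : ℝ => 1 / (x + δ)) h (by fun_prop) hc2, ← e2]
  · rw [← CStarRing.norm_star_mul_self, star_mul, hk]
    have e2 : h = cfc (fun x : ℝ => x) h := (cfc_id' ℝ h).symm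
    have : cfc (fun x : ℝ => δ / (x + δ)) h * star y * (y * cfc (fun x : ℝ => δ / (x + δ)) h)
        = cfc (fun x : ℝ => δ / (x + δ) * (x * (δ / (x + δ)))) h := by
      rw [cfc_mul (fun x : ℝ => δ / (x + δ)) (fun x : ℝ => x * (δ / (x + δ))) h hc1
          ((by fun_prop : ContinuousOn (fun x : ℝ => x) _).mul hc1),
        cfc_mul (fun x : ℝ => x) (fun x : ℝ => δ / (x + δ)) h (by fun_prop) hc1, ← e2, hh]
      simp only [mul_assoc]
    rw [this]
    refine norm_cfc_le hδ.le fun x hx => ?_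
    have h0 := hpos x hx
    rw [Real.norm_of_nonneg (by positivity)]
    have : x / (x + δ) ≤ 1 := by rw [div_le_one (by positivity)]; linarith
    have h2 : δ / (x + δ) ≤ 1 := by rw [div_le_one (by positivity)]; linarith
    calc δ / (x + δ) * (x * (δ / (x + δ))) = δ * (x / (x + δ) * (δ / (x + δ))) := by ring
      _ ≤ δ * (1 * 1) := by gcongr
      _ = δ := by ring

variable (I : Ideal A) [hI : I.IsTwoSided]

theorem star_mem [hcl : IsClosed (I : Set A)] {x : A} (hx : x ∈ I) : star x ∈ I := by
  have : star x ∈ closure (I : Set A) := by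
    refine Metric.mem_closure_iff.2 fun ε hε => ?_
    obtain ⟨k, r, -, -, hr, hy⟩ := exists_cutoff (star x) (δ := (ε / 2) ^ 2) (by positivity)
    refine ⟨star x * (1 - k), ?_, ?_⟩
    · rw [hr, star_star]
      exact I.mul_mem_left _ (I.mul_mem_right _ (I.mul_mem_right _ hx))
    · rw [dist_eq_norm, mul_sub, mul_one, sub_sub_cancel]
      have : ‖star x * k‖ ≤ ε / 2 := by
        refine le_of_sq_le_sq ?_ (by positivity)
        simpa [sq] using hy
      linarith
  rwa [hcl.closure_eq] at this

theorem norm_mk_lt' (x : A ⧸ I) {ε : ℝ} (hε : 0 < ε) :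
    ∃ a : A, Ideal.Quotient.mk I a = x ∧ ‖a‖ < ‖x‖ + ε :=
  Submodule.Quotient.norm_mk_lt (S := I) x hε

theorem norm_mk_le' (a : A) : ‖Ideal.Quotient.mk I a‖ ≤ ‖a‖ :=
  Submodule.Quotient.norm_mk_le (S := I) a

variable [hcl : IsClosed (I : Set A)]

instance quotientStar : Star (A ⧸ I) where
  star := Quotient.map' star fun a b hab => by
    rw [Submodule.quotientRel_def] at hab ⊢
    rw [← star_sub]
    exact star_mem I hab

theorem star_mk (a : A) : star (Ideal.Quotient.mk I a) = Ideal.Quotient.mk I (star a) := rfl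

/-- The quotient of a C⋆-algebra by a closed two-sided ideal, with the quotient norm. -/
instance quotientCStarAlgebra : CStarAlgebra (A ⧸ I) where
  toNormedRing :=
    { (inferInstance : Ring (A ⧸ I)), Submodule.Quotient.normedAddCommGroup I with
      dist_eq := dist_eq_norm_neg_add
      norm_mul_le := fun x y => by
        have key : ∀ ε : ℝ, 0 < ε → ‖x * y‖ ≤ (‖x‖ + ε) * (‖y‖ + ε) := fun ε hε => by
          obtain ⟨a, rfl, ha⟩ := norm_mk_lt' I x hε
          obtain ⟨b, rfl, hb⟩ := norm_mk_lt' I y hε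
          calc _ ≤ ‖a * b‖ := by rw [← map_mul]; exact norm_mk_le' I _
            _ ≤ ‖a‖ * ‖b‖ := norm_mul_le _ _
            _ ≤ _ := by gcongr
        have ht : Filter.Tendsto (fun ε : ℝ => (‖x‖ + ε) * (‖y‖ + ε)) (nhdsWithin 0 (Set.Ioi 0))
            (nhds (‖x‖ * ‖y‖)) := by
          have : Continuous fun ε : ℝ => (‖x‖ + ε) * (‖y‖ + ε) := by fun_prop
          simpa using (this.tendsto 0).mono_left nhdsWithin_le_nhds
        exact ge_of_tendsto ht (Filter.eventually_of_mem self_mem_nhdsWithin key) }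
  star_involutive x := by
    obtain ⟨a, rfl⟩ := Ideal.Quotient.mk_surjective x
    simp only [star_mk, star_star]
  star_mul x y := by
    obtain ⟨a, rfl⟩ := Ideal.Quotient.mk_surjective x
    obtain ⟨b, rfl⟩ := Ideal.Quotient.mk_surjective y
    simp only [star_mk, ← map_mul, star_mul]
  star_add x y := by
    obtain ⟨a, rfl⟩ := Ideal.Quotient.mk_surjective x
    obtain ⟨b, rfl⟩ := Ideal.Quotient.mk_surjective y
    simp only [star_mk, ← map_add, star_add]
  complete := (Submodule.Quotient.completeSpace I).complete
  norm_mul_self_le x := by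
    obtain ⟨a, rfl⟩ := Ideal.Quotient.mk_surjective x
    have key : ∀ ε : ℝ, 0 < ε →
        ‖Ideal.Quotient.mk I a‖ * ‖Ideal.Quotient.mk I a‖
          ≤ ‖star (Ideal.Quotient.mk I a) * Ideal.Quotient.mk I a‖ + ε + ε := fun ε hε => by
      obtain ⟨b, hb, hbn⟩ :=
        norm_mk_lt' I (star (Ideal.Quotient.mk I a) * Ideal.Quotient.mk I a) hε
      have hi : star a * a - b ∈ I := by
        rw [← Ideal.Quotient.eq, hb, star_mk, map_mul]
      obtain ⟨k, r, hk, hk1, hr, hy⟩ := exists_cutoff (star a * a - b) (δ := ε ^ 2) (by positivity)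
      have hik : ‖(star a * a - b) * k‖ ≤ ε := by
        refine le_of_sq_le_sq ?_ hε.le
        simpa [sq] using hy
      have hq : Ideal.Quotient.mk I (a * k) = Ideal.Quotient.mk I a := by
        rw [Ideal.Quotient.eq]
        have : a * k - a = -(a * (1 - k)) := by noncomm_ring
        rw [this, hr]
        exact I.neg_mem (I.mul_mem_left _ (I.mul_mem_right _ (I.mul_mem_left _ hi)))
      calc _ ≤ ‖a * k‖ * ‖a * k‖ := by
            rw [← hq]; gcongr <;> exact norm_mk_le' I _
        _ = ‖star (a * k) * (a * k)‖ := CStarRing.norm_star_mul_self.symm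
        _ = ‖k * ((star a * a - b) * k) + k * b * k‖ := by
            rw [star_mul, hk]; congr 1; noncomm_ring
        _ ≤ ‖k‖ * ‖(star a * a - b) * k‖ + ‖k‖ * ‖b‖ * ‖k‖ := by
            refine (norm_add_le _ _).trans (add_le_add (norm_mul_le _ _) ?_)
            exact (norm_mul_le _ _).trans (by gcongr; exact norm_mul_le _ _)
        _ ≤ 1 * ε + 1 * (‖star (Ideal.Quotient.mk I a) * Ideal.Quotient.mk I a‖ + ε) * 1 := by
            gcongr
        _ = _ := by ring
    refine le_of_forall_pos_le_add fun ε hε => ?_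
    have := key (ε / 2) (by positivity)
    linarith
  toAlgebra := inferInstance
  norm_smul_le := (Submodule.Quotient.normedSpace I ℂ).norm_smul_le
  star_smul z x := by
    obtain ⟨a, rfl⟩ := Ideal.Quotient.mk_surjective x
    change star (Ideal.Quotient.mk I (z • a)) = Ideal.Quotient.mk I (star z • star a)
    rw [star_mk, star_smul]

end QuotientCStar

/-! ### Quasi-lattice order, Nica covariance and the universal C⋆-algebra `C*(G, P)` -/

section Nica

variable {G : Type} [Group G] (P : Submonoid G)

/-- The left-invariant relation `g ≤ h ↔ g⁻¹ h ∈ P`. -/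
def LeftLE (g h : G) : Prop := g⁻¹ * h ∈ P

/-- `g ∨ h < ∞`: the elements `g`, `h` have a common upper bound in `P`. -/
def JoinFinite (g h : G) : Prop := ∃ k ∈ P, LeftLE P g k ∧ LeftLE P h k

/-- `k = g ∨ h`: the element `k` is the least upper bound of `g` and `h` in `P`. -/
def IsJoin (g h k : G) : Prop :=
  k ∈ P ∧ LeftLE P g k ∧ LeftLE P h k ∧
    ∀ l ∈ P, LeftLE P g l → LeftLE P h l → LeftLE P k l

/-- A Nica-covariant isometric representation of `P` in a unital C⋆-algebra. -/
structure IsNicaCovariant {B : Type*} [CStarAlgebra B] (S : P →* B) : Prop where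
  isometry : ∀ x : P, star (S x) * S x = 1
  join : ∀ x y z : P, IsJoin P (x : G) y z →
    S x * star (S x) * (S y * star (S y)) = S z * star (S z)
  disjoint : ∀ x y : P, ¬ JoinFinite P (x : G) y →
    S x * star (S x) * (S y * star (S y)) = 0

/-- The Nica-covariant representations of `P` in nonzero unital C⋆-algebras. -/
structure NicaRep where
  B : Type
  [cstar : CStarAlgebra B]
  [nontrivial : Nontrivial B]
  S : P →* B
  cov : IsNicaCovariant P S

instance instNicaRepCStarAlgebra (i : NicaRep P) : CStarAlgebra i.B := i.cstar
instance instNicaRepNontrivial (i : NicaRep P) : Nontrivial i.B := i.nontrivial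

theorem IsNicaCovariant.norm_le {B : Type*} [CStarAlgebra B] [Nontrivial B] {S : P →* B}
    (h : IsNicaCovariant P S) (x : P) : ‖S x‖ ≤ 1 := by
  have h1 : ‖S x‖ * ‖S x‖ = 1 := by
    rw [← CStarRing.norm_star_mul_self, h.isometry, CStarRing.norm_one]
  nlinarith [norm_nonneg (S x)]

/-- The C⋆-algebra of bounded families indexed by all Nica-covariant representations. -/
abbrev NicaProd : Type 1 := lp (fun i : NicaRep P => i.B) ∞

instance NicaProd.instCStarAlgebra : CStarAlgebra (NicaProd P) where

/-- The direct sum of all Nica-covariant representations. -/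
def NicaProd.rep : P →* NicaProd P where
  toFun x := ⟨fun i => i.S x, memℓp_infty ⟨1, by
    rintro _ ⟨i, rfl⟩
    exact i.cov.norm_le P x⟩⟩
  map_one' := by ext i; exact map_one i.S
  map_mul' x y := by ext i; exact map_mul i.S x y

/-- The closed unital ⋆-subalgebra generated by the direct sum of all Nica-covariant
representations. -/
def NicaProd.subalgebra : StarSubalgebra ℂ (NicaProd P) :=
  (StarAlgebra.adjoin ℂ (Set.range (NicaProd.rep P))).topologicalClosure

instance NicaProd.isClosed_subalgebra : IsClosed (NicaProd.subalgebra P : Set (NicaProd P)) :=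
  StarSubalgebra.isClosed_topologicalClosure _

/-- The universal C⋆-algebra `C*(G, P)` generated by a Nica-covariant representation of `P`,
realised as the C⋆-algebra generated by the direct sum of all such representations. (Such a
representation generates a separable C⋆-algebra when `P` is countable, so representations in
C⋆-algebras in `Type` suffice.) -/
def NicaAlg : Type 1 := NicaProd.subalgebra P

instance NicaAlg.instCStarAlgebra : CStarAlgebra (NicaAlg P) :=
  inferInstanceAs (CStarAlgebra (NicaProd.subalgebra P))

namespace NicaAlg

/-- The inclusion of `C*(G, P)` in the product. -/
def incl : NicaAlg P →⋆ₐ[ℂ] NicaProd P := (NicaProd.subalgebra P).subtype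

theorem incl_injective : Function.Injective (incl P) := Subtype.val_injective

theorem rep_mem (x : P) : NicaProd.rep P x ∈ NicaProd.subalgebra P :=
  StarSubalgebra.le_topologicalClosure _ (StarAlgebra.subset_adjoin ℂ _ ⟨x, rfl⟩)

/-- The universal Nica-covariant representation `x ↦ T_x`. -/
def T : P →* NicaAlg P where
  toFun x := ⟨NicaProd.rep P x, rep_mem P x⟩
  map_one' := incl_injective P (map_one (NicaProd.rep P))
  map_mul' x y := incl_injective P (map_mul (NicaProd.rep P) x y)

theorem incl_T (x : P) : incl P (T P x) = NicaProd.rep P x := rfl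

theorem T_cov : IsNicaCovariant P (T P) where
  isometry x := by
    refine incl_injective P (lp.ext (funext fun i => ?_))
    exact i.cov.isometry x
  join x y z h := by
    refine incl_injective P (lp.ext (funext fun i => ?_))
    exact i.cov.join x y z h
  disjoint x y h := by
    refine incl_injective P (lp.ext (funext fun i => ?_))
    exact i.cov.disjoint x y h

/-- The homomorphism `π_S : C*(G, P) → B` with `π_S (T_x) = S_x`. -/
def lift (i : NicaRep P) : NicaAlg P →⋆ₐ[ℂ] i.B where
  toFun a := incl P a i
  map_one' := rfl
  map_mul' _ _ := rfl
  map_zero' := rfl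
  map_add' _ _ := rfl
  commutes' _ := rfl
  map_star' _ := rfl

theorem lift_T (i : NicaRep P) (x : P) : lift P i (T P x) = i.S x := rfl

end NicaAlg

/-! ### The gauge action -/

variable (θ : G →* Multiplicative ℤ)

/-- The height of an element, as an integer. -/
def height (g : G) : ℤ := Multiplicative.toAdd (θ g)

/-- The phase `e^{itθ(g)}`. -/
def phase (t : ℝ) (g : G) : ℂ := Complex.exp (Complex.I * t * height θ g)

theorem height_mul (g h : G) : height θ (g * h) = height θ g + height θ h := by
  simp [height]

theorem height_one : height θ (1 : G) = 0 := by simp [height]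

theorem phase_mul (t : ℝ) (g h : G) : phase θ t (g * h) = phase θ t g * phase θ t h := by
  simp only [phase, height_mul, ← Complex.exp_add]
  push_cast
  ring_nf

theorem phase_add (s t : ℝ) (g : G) : phase θ (s + t) g = phase θ s g * phase θ t g := by
  simp only [phase, ← Complex.exp_add]
  push_cast
  ring_nf

theorem phase_one (t : ℝ) : phase θ t (1 : G) = 1 := by simp [phase, height_one]

theorem phase_zero (g : G) : phase θ 0 g = 1 := by simp [phase]

theorem star_phase_mul (t : ℝ) (g : G) : star (phase θ t g) * phase θ t g = 1 := by
  simp only [phase, Complex.star_def, ← Complex.exp_conj, ← Complex.exp_add]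
  simp

theorem phase_mul_star (t : ℝ) (g : G) : phase θ t g * star (phase θ t g) = 1 := by
  rw [mul_comm, star_phase_mul]

variable {P}

/-- The representation `x ↦ e^{itθ(x)} S_x`. -/
def twistHom {B : Type*} [CStarAlgebra B] (S : P →* B) (t : ℝ) : P →* B where
  toFun x := phase θ t x • S x
  map_one' := by simp [phase_one]
  map_mul' x y := by
    simp only [Submonoid.coe_mul, phase_mul, map_mul, smul_mul_smul_comm]

theorem twistHom_range {B : Type*} [CStarAlgebra B] (S : P →* B) (t : ℝ) (x : P) :
    twistHom θ S t x * star (twistHom θ S t x) = S x * star (S x) := by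
  simp only [twistHom, MonoidHom.coe_mk, OneHom.coe_mk, star_smul, smul_mul_smul_comm,
    phase_mul_star, one_smul]

theorem twistHom_cov {B : Type*} [CStarAlgebra B] {S : P →* B} (h : IsNicaCovariant P S) (t : ℝ) :
    IsNicaCovariant P (twistHom θ S t) where
  isometry x := by
    simp only [twistHom, MonoidHom.coe_mk, OneHom.coe_mk, star_smul, smul_mul_smul_comm,
      star_phase_mul, one_smul, h.isometry]
  join x y z hj := by simpa only [twistHom_range] using h.join x y z hj
  disjoint x y hj := by simpa only [twistHom_range] using h.disjoint x y hj

/-- The representation `x ↦ e^{itθ(x)} S_x` as an index of the product. -/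
def NicaRep.twist (t : ℝ) (i : NicaRep P) : NicaRep P where
  B := i.B
  S := twistHom θ i.S t
  cov := twistHom_cov θ i.cov t

theorem NicaRep.mk_congr {B : Type} [CStarAlgebra B] [Nontrivial B] {S S' : P →* B}
    (hS : IsNicaCovariant P S) (hS' : IsNicaCovariant P S') (h : S = S') :
    NicaRep.mk B S hS = NicaRep.mk B S' hS' := by
  subst h; rfl

theorem NicaRep.twist_twist (s t : ℝ) (i : NicaRep P) :
    (i.twist θ s).twist θ t = i.twist θ (s + t) := by
  refine NicaRep.mk_congr _ _ (MonoidHom.ext fun x => ?_)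
  change phase θ t x • phase θ s x • i.S x = phase θ (s + t) x • i.S x
  rw [smul_smul, phase_add, mul_comm]

theorem NicaRep.twist_zero (i : NicaRep P) : i.twist θ 0 = i := by
  refine NicaRep.mk_congr _ i.cov (MonoidHom.ext fun x => ?_)
  change phase θ 0 x • i.S x = i.S x
  rw [phase_zero, one_smul]

/-- The endomorphism of the product given by twisting the index. -/
def prodGauge (t : ℝ) : NicaProd P →⋆ₐ[ℂ] NicaProd P where
  toFun f := ⟨fun i => f (i.twist θ t), memℓp_infty ⟨‖f‖, by
    rintro _ ⟨i, rfl⟩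
    exact lp.norm_apply_le_norm ENNReal.top_ne_zero f (i.twist θ t)⟩⟩
  map_one' := rfl
  map_mul' _ _ := rfl
  map_zero' := rfl
  map_add' _ _ := rfl
  commutes' _ := rfl
  map_star' _ := rfl

theorem prodGauge_rep (t : ℝ) (x : P) :
    prodGauge θ t (NicaProd.rep P x) = phase θ t x • NicaProd.rep P x :=
  lp.ext (funext fun _ => rfl)

theorem prodGauge_mem (t : ℝ) {f : NicaProd P} (hf : f ∈ NicaProd.subalgebra P) :
    prodGauge θ t f ∈ NicaProd.subalgebra P := by
  have hc : Continuous (prodGauge (P := P) θ t) :=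
    AddMonoidHomClass.continuous_of_bound (prodGauge (P := P) θ t) 1 fun f => by
      rw [one_mul]
      exact NonUnitalStarAlgHom.norm_apply_le _ f
  have hle : NicaProd.subalgebra P ≤ (NicaProd.subalgebra P).comap (prodGauge θ t) := by
    refine StarSubalgebra.topologicalClosure_minimal ?_ ?_
    · refine StarAlgebra.adjoin_le ?_
      rintro _ ⟨x, rfl⟩
      change prodGauge θ t (NicaProd.rep P x) ∈ NicaProd.subalgebra P
      rw [prodGauge_rep]
      exact (NicaProd.subalgebra P).smul_mem (NicaAlg.rep_mem P x) _
    · exact (inferInstance : IsClosed (NicaProd.subalgebra P : Set (NicaProd P))).preimage hc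
  exact hle hf

/-- The endomorphism `α_t` of `C*(G, P)`. -/
def gaugeHom (t : ℝ) : NicaAlg P →⋆ₐ[ℂ] NicaAlg P :=
  StarAlgHom.codRestrict ((prodGauge θ t).comp (NicaAlg.incl P)) (NicaProd.subalgebra P)
    fun a => prodGauge_mem θ t a.2

theorem incl_gaugeHom (t : ℝ) (a : NicaAlg P) :
    NicaAlg.incl P (gaugeHom θ t a) = prodGauge θ t (NicaAlg.incl P a) := rfl

theorem gaugeHom_add (s t : ℝ) (a : NicaAlg P) :
    gaugeHom θ s (gaugeHom θ t a) = gaugeHom θ (s + t) a := by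
  refine NicaAlg.incl_injective P (lp.ext (funext fun i => ?_))
  exact eq_of_heq (congr_arg_heq (NicaAlg.incl P a) (NicaRep.twist_twist θ s t i))

theorem gaugeHom_zero (a : NicaAlg P) : gaugeHom θ 0 a = a := by
  refine NicaAlg.incl_injective P (lp.ext (funext fun i => ?_))
  exact eq_of_heq (congr_arg_heq (NicaAlg.incl P a) (NicaRep.twist_zero θ i))

/-- The automorphism `α_t` of `C*(G, P)`. -/
def gaugeAut (t : ℝ) : NicaAlg P ≃⋆ₐ[ℂ] NicaAlg P where
  toFun := gaugeHom θ t
  invFun := gaugeHom θ (-t)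
  left_inv a := by rw [gaugeHom_add, neg_add_cancel, gaugeHom_zero]
  right_inv a := by rw [gaugeHom_add, add_neg_cancel, gaugeHom_zero]
  map_mul' := map_mul _
  map_add' := map_add _
  map_star' := map_star _
  map_smul' := map_smul _

theorem gaugeAut_T (t : ℝ) (x : P) :
    gaugeAut θ t (NicaAlg.T P x) = phase θ t x • NicaAlg.T P x :=
  NicaAlg.incl_injective P (prodGauge_rep θ t x)

end Nica

/-! ### Closed ideals, states and KMS states -/

section KMS

variable {A : Type*} [CStarAlgebra A]

/-- The closed two-sided ideal generated by an element. -/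
def closedIdeal (p : A) : Ideal A := (TwoSidedIdeal.span {p}).asIdeal.closure

instance isClosed_closedIdeal (p : A) : IsClosed (closedIdeal p : Set A) := isClosed_closure

instance isTwoSided_closedIdeal (p : A) : (closedIdeal p).IsTwoSided where
  mul_mem_of_left {_} b ha :=
    map_mem_closure (f := fun x => x * b) (continuous_mul_const b) ha
      fun _ hx => (TwoSidedIdeal.span {p}).mul_mem_right _ _ hx

theorem mem_closedIdeal (p : A) : p ∈ closedIdeal p :=
  subset_closure (TwoSidedIdeal.subset_span rfl)

theorem closedIdeal_map (p : A) (f : A ≃⋆ₐ[ℂ] A) (hf : f p = p) {a : A}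
    (ha : a ∈ closedIdeal p) : f a ∈ closedIdeal p := by
  have hc : Continuous f :=
    AddMonoidHomClass.continuous_of_bound f 1 fun a => by
      rw [one_mul]; exact NonUnitalStarAlgHom.norm_apply_le _ a
  refine map_mem_closure hc ha fun x hx => ?_
  have hle : TwoSidedIdeal.span {p} ≤ (TwoSidedIdeal.span {p}).comap f := by
    rw [TwoSidedIdeal.span_le, Set.singleton_subset_iff]
    change p ∈ (TwoSidedIdeal.span {p}).comap f
    rw [TwoSidedIdeal.mem_comap, hf]
    exact TwoSidedIdeal.subset_span rfl
  exact (TwoSidedIdeal.mem_comap f).1 (hle hx)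

/-- The endomorphism of the quotient induced by an automorphism that fixes the generator. -/
def quotientHom (p : A) (f : A ≃⋆ₐ[ℂ] A) (hf : f p = p) :
    (A ⧸ closedIdeal p) →⋆ₐ[ℂ] (A ⧸ closedIdeal p) where
  __ := Ideal.quotientMapₐ (closedIdeal p) (f : A →ₐ[ℂ] A) fun _ ha => closedIdeal_map p f hf ha
  map_star' x := by
    obtain ⟨a, rfl⟩ := Ideal.Quotient.mk_surjective x
    exact congrArg (Ideal.Quotient.mk (closedIdeal p)) (map_star f a)

theorem quotientHom_mk (p : A) (f : A ≃⋆ₐ[ℂ] A) (hf : f p = p) (a : A) :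
    quotientHom p f hf (Ideal.Quotient.mk _ a) = Ideal.Quotient.mk _ (f a) := rfl

/-- The automorphism of the quotient induced by an automorphism that fixes the generator. -/
def quotientAut (p : A) (f : A ≃⋆ₐ[ℂ] A) (hf : f p = p) :
    (A ⧸ closedIdeal p) ≃⋆ₐ[ℂ] (A ⧸ closedIdeal p) where
  toFun := quotientHom p f hf
  invFun := quotientHom p f.symm (by rw [← hf, f.symm_apply_apply, hf])
  left_inv x := by
    obtain ⟨a, rfl⟩ := Ideal.Quotient.mk_surjective x
    rw [quotientHom_mk, quotientHom_mk, f.symm_apply_apply]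
  right_inv x := by
    obtain ⟨a, rfl⟩ := Ideal.Quotient.mk_surjective x
    rw [quotientHom_mk, quotientHom_mk, f.apply_symm_apply]
  map_mul' := map_mul _
  map_add' := map_add _
  map_star' := map_star _
  map_smul' := map_smul _

/-- States of a unital C⋆-algebra. -/
structure IsState (φ : A →ₗ[ℂ] ℂ) : Prop where
  map_one : φ 1 = 1
  nonneg : ∀ a : A, 0 ≤ φ (star a * a)

/-- KMS states at inverse temperature `β`: `φ (a b) = φ (b α_{iβ}(a))` for every analytic element
`a` (one for which `t ↦ α_t(a)` extends to an entire function `F`, so `α_{iβ}(a) = F (iβ)`) and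
every `b`. -/
structure IsKMS (α : ℝ → A ≃⋆ₐ[ℂ] A) (β : ℝ) (φ : A →ₗ[ℂ] ℂ) : Prop where
  state : IsState φ
  kms : ∀ (a b : A) (F : ℂ → A), Differentiable ℂ F → (∀ t : ℝ, F t = α t a) →
    φ (a * b) = φ (b * F (Complex.I * β))

end KMS

/-! ### Baumslag–Solitar groups -/

namespace BS

variable (c d : ℕ)

/-- The relator `a b^c (b^d a)⁻¹`; the generator `a` is `true` and `b` is `false`. -/
def rels : Set (FreeGroup Bool) :=
  {FreeGroup.of true * FreeGroup.of false ^ c * (FreeGroup.of false ^ d * FreeGroup.of true)⁻¹}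

/-- The Baumslag–Solitar group `⟨a, b : a b^c = b^d a⟩`. -/
abbrev Grp : Type := PresentedGroup (rels c d)

/-- The generator `a`. -/
def a : Grp c d := PresentedGroup.of true

/-- The generator `b`. -/
def b : Grp c d := PresentedGroup.of false

/-- The submonoid `P` generated by `a` and `b`. -/
def P : Submonoid (Grp c d) := Submonoid.closure {a c d, b c d}

/-- The height homomorphism, with `θ(a) = 1` and `θ(b) = 0`. -/
def θ : Grp c d →* Multiplicative ℤ :=
  PresentedGroup.toGroup (f := fun s : Bool => Multiplicative.ofAdd (if s then (1 : ℤ) else 0))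
    (by rintro r rfl; simp)

/-- The generator `a` as an element of `P`. -/
def aP : P c d := ⟨a c d, Submonoid.subset_closure (by simp)⟩

/-- The generator `b` as an element of `P`. -/
def bP : P c d := ⟨b c d, Submonoid.subset_closure (by simp)⟩

/-- The Toeplitz algebra `C*(G, P)`. -/
abbrev Toeplitz : Type 1 := NicaAlg (P c d)

/-- The universal Nica-covariant representation. -/
abbrev T : P c d →* Toeplitz c d := NicaAlg.T (P c d)

/-- The dynamics `α` on `C*(G, P)`, with `α_t(T_x) = e^{itθ(x)} T_x`. -/
abbrev α : ℝ → Toeplitz c d ≃⋆ₐ[ℂ] Toeplitz c d := gaugeAut (θ c d)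

/-- The element `1 - ∑_{0 ≤ j < d} T_{b^j a} T_{b^j a}^*`. -/
def defect : Toeplitz c d :=
  1 - ∑ j ∈ Finset.range d, T c d (bP c d ^ j * aP c d) * star (T c d (bP c d ^ j * aP c d))

theorem α_defect (t : ℝ) : α c d t (defect c d) = defect c d := by
  have h : ∀ x : P c d, α c d t (T c d x * star (T c d x)) = T c d x * star (T c d x) := by
    intro x
    rw [map_mul, map_star, gaugeAut_T, star_smul, smul_mul_smul_comm, phase_mul_star, one_smul]
  rw [defect, map_sub, map_one, map_sum]
  simp only [h]

/-- The Cuntz algebra `𝒪(G, P) = C*(G, P) / I`, where `I` is the closed two-sided ideal generated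
by `defect`. -/
abbrev Cuntz : Type 1 := Toeplitz c d ⧸ closedIdeal (defect c d)

/-- The quotient map `C*(G, P) → 𝒪(G, P)`. -/
def q : Toeplitz c d →⋆ₐ[ℂ] Cuntz c d where
  __ := Ideal.Quotient.mkₐ ℂ (closedIdeal (defect c d))
  map_star' _ := rfl

/-- The image `T̄_x` of `T_x` in `𝒪(G, P)`. -/
def Tbar (x : P c d) : Cuntz c d := q c d (T c d x)

/-- The dynamics induced by `α` on `𝒪(G, P)`. -/
def αbar (t : ℝ) : Cuntz c d ≃⋆ₐ[ℂ] Cuntz c d :=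
  quotientAut (defect c d) (α c d t) (α_defect c d t)

theorem αbar_q (t : ℝ) (x : Toeplitz c d) : αbar c d t (q c d x) = q c d (α c d t x) := rfl

/-- The moment `∫ zⁿ dμ(z)` of a measure on the circle `ℝ/ℤ`, where `z = e^{2πix}`. -/
def moment (μ : Measure UnitAddCircle) (n : ℤ) : ℂ := ∫ x, (fourier n x : ℂ) ∂μ

open Classical in
/-- The value `(1 - e^{-β} d) (M_t(μ) + ∑ e^{-βk} d^k M_{c^k d^{-k} t}(μ))`, where the sum is over
those `k ≥ 1` such that `d` divides the number `c^j d^{-j} t` (that is, `d^{j+1} ∣ c^j t`)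
for `0 ≤ j < k`. -/
def momentValue (β : ℝ) (μ : Measure UnitAddCircle) (t : ℕ) : ℂ :=
  (1 - Real.exp (-β) * d) * (moment μ t +
    ∑' k : ℕ, if 1 ≤ k ∧ ∀ j < k, d ^ (j + 1) ∣ c ^ j * t then
      (Real.exp (-β * k) * d ^ k : ℂ) * moment μ ((c ^ k * t / d ^ k : ℕ) : ℤ) else 0)

/-- `φ` is the KMS state `ψ_{β,μ}` on `C*(G, P)`. -/
structure IsPsi (β : ℝ) (μ : Measure UnitAddCircle) (φ : Toeplitz c d →ₗ[ℂ] ℂ) : Prop where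
  kms : IsKMS (α c d) β φ
  value : ∀ t : ℕ, φ (T c d (bP c d ^ t)) = momentValue c d β μ t

end BS

end

/-! Everything reduces to one kind of state, called canonical at `β`: its value at `T_x T_x^*` is
`e^{-βθ(x)}`, and it vanishes at `T_x T_y^*` for `x ≠ y`. Common upper bounds in `P` can be refined
to least ones (`exists_isJoin`), so Nica covariance makes the span of the elements `T_x T_y^*` a
dense ⋆-subalgebra. Hence there is at most one canonical state for each `β`, and weak* convergence
can be tested on these elements, where the values are continuous in `β`. A canonical state is KMS
because a product of two monomials and the product in the other order are diagonal together, with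
matching heights (`exists_isJoin_swap`).

Existence uses the monoid `Q` generated by `a`, `b`, `b⁻¹`. Each of its elements is uniquely
`b^{s_1} a ⋯ b^{s_n} a b^m` with `0 ≤ s_i < d` and `m ∈ ℤ`; uniqueness comes from Britton's lemma in
an HNN extension of `ℤ`. On `ℓ²(Q)` the operator of `b` is unitary, as the value `1` at `T_b T_b^*`
demands. Averaging vector states over the `d^n` words `b^{s_1} a ⋯ b^{s_n} a` gives `d^{-θ(x)}` at
`T_x T_x^*` if `θ(x) ≤ n`, and `0` otherwise (`avgState_diag`). A geometric mixture over `n` is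
canonical for `β > ln d`; a limit point as `n → ∞` is canonical for `β = ln d`. The latter kills the
projection `defect`, so it descends to the quotient.

Conversely, for `β ≠ 0` a KMS state that vanishes at all `T_{b^t}`, `t > 0`, is canonical
(`isCanonical_of_isKMS`). For Haar measure all the moments concerned vanish, which identifies
`ψ_{β,Haar}` (`isPsi_iff`). On the quotient, the relation `∑ T̄_{b^j a} T̄_{b^j a}^* = 1` forces `d
e^{-β} = 1`, makes `φ(T̄_{b^t})` vanish for `d ∤ t`, and equates the values at `b^{ds}` and
`b^{cs}`. If `d ∤ c`, some prime has smaller valuation in `c` than in `d`, and descent on that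
valuation kills every `φ(T̄_{b^t})`. -/

namespace BS

/-! ### Words and heights in the Baumslag–Solitar monoid -/

section Group

variable {c d : ℕ}

theorem a_mul_b_pow : a c d * b c d ^ c = b c d ^ d * a c d := by
  have h : PresentedGroup.mk (rels c d) (FreeGroup.of true * FreeGroup.of false ^ c *
      (FreeGroup.of false ^ d * FreeGroup.of true)⁻¹) = 1 :=
    PresentedGroup.one_of_mem rfl
  simp only [map_mul, map_inv, map_pow] at h
  exact mul_inv_eq_one.1 h

theorem b_zpow_mul_a (n : ℤ) :
    b c d ^ ((d : ℤ) * n) * a c d = a c d * b c d ^ ((c : ℤ) * n) := by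
  have h : SemiconjBy (a c d) (b c d ^ c) (b c d ^ d) := a_mul_b_pow
  have := h.zpow_right n
  rw [zpow_mul, zpow_mul, zpow_natCast, zpow_natCast]
  exact this.eq.symm

theorem b_pow_mul_a (n : ℕ) :
    b c d ^ (d * n) * a c d = a c d * b c d ^ (c * n) := by
  simpa only [← zpow_natCast, Nat.cast_mul] using b_zpow_mul_a (c := c) (d := d) n

@[simp] theorem height_a : height (θ c d) (a c d) = 1 := by
  simp [height, θ, a]

@[simp] theorem height_b : height (θ c d) (b c d) = 0 := by
  simp [height, θ, b]

@[simp] theorem height_b_zpow (n : ℤ) : height (θ c d) (b c d ^ n) = 0 := by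
  have h : θ c d (b c d) = 1 := height_b (c := c) (d := d)
  simp [height, h]

@[simp] theorem height_b_pow (n : ℕ) : height (θ c d) (b c d ^ n) = 0 := by
  simpa using height_b_zpow (c := c) (d := d) n

theorem height_inv (g : Grp c d) : height (θ c d) g⁻¹ = -height (θ c d) g := by
  simp [height]

theorem a_mem : a c d ∈ P c d := Submonoid.subset_closure (by simp)

theorem b_mem : b c d ∈ P c d := Submonoid.subset_closure (by simp)

variable (c d) in
/-- The submonoid generated by `a`, `b` and `b⁻¹`. -/
def Q : Submonoid (Grp c d) := Submonoid.closure {a c d, b c d, (b c d)⁻¹}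

theorem a_mem_Q : a c d ∈ Q c d := Submonoid.subset_closure (by simp)

theorem b_mem_Q : b c d ∈ Q c d := Submonoid.subset_closure (by simp)

theorem b_inv_mem_Q : (b c d)⁻¹ ∈ Q c d := Submonoid.subset_closure (by simp)

theorem b_zpow_mem_Q (n : ℤ) : b c d ^ n ∈ Q c d := by
  cases n with
  | ofNat n => simpa using pow_mem b_mem_Q n
  | negSucc n =>
    simpa [zpow_negSucc, ← inv_pow] using pow_mem (b_inv_mem_Q (c := c) (d := d)) (n + 1)

theorem P_le_Q : P c d ≤ Q c d := Submonoid.closure_mono (by grind)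

theorem mem_P_cases {x : Grp c d} (hd : 0 < d) (hx : x ∈ P c d) :
    (∃ m : ℕ, x = b c d ^ m) ∨ ∃ s < d, ∃ y ∈ P c d, x = b c d ^ s * a c d * y := by
  induction hx using Submonoid.closure_induction_left with
  | one => exact .inl ⟨0, by simp⟩
  | mul_left x hx y hy ih =>
    rcases hx with rfl | rfl
    · exact .inr ⟨0, hd, y, hy, by simp⟩
    · rcases ih with ⟨m, rfl⟩ | ⟨s, hs, z, hz, rfl⟩
      · exact .inl ⟨m + 1, by rw [pow_succ']⟩
      · rcases Nat.lt_or_ge (s + 1) d with h | h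
        · exact .inr ⟨s + 1, h, z, hz, by simp only [pow_succ', mul_assoc]⟩
        · obtain rfl : d = s + 1 := by lia
          refine .inr ⟨0, hd, b c (s + 1) ^ c * z, mul_mem (pow_mem b_mem _) hz, ?_⟩
          rw [pow_zero, one_mul, ← mul_assoc (a c (s + 1)), a_mul_b_pow, pow_succ']
          simp only [mul_assoc]

theorem mem_Q_cases {x : Grp c d} (hd : 0 < d) (hx : x ∈ Q c d) :
    (∃ m : ℤ, x = b c d ^ m) ∨ ∃ s < d, ∃ y ∈ Q c d, x = b c d ^ s * a c d * y := by
  induction hx using Submonoid.closure_induction_left with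
  | one => exact .inl ⟨0, by simp⟩
  | mul_left x hx y hy ih =>
    have hb : ∀ n : ℤ, (∃ m : ℤ, b c d ^ n * y = b c d ^ m) ∨
        ∃ s < d, ∃ z ∈ Q c d, b c d ^ n * y = b c d ^ s * a c d * z := by
      intro n
      rcases ih with ⟨m, rfl⟩ | ⟨s, hs, z, hz, rfl⟩
      · exact .inl ⟨n + m, by rw [zpow_add]⟩
      · have hd' : (0 : ℤ) < d := by exact_mod_cast hd
        have h0 := Int.emod_nonneg (n + s) hd'.ne'
        -- Euclidean division of `n + s` by `d`: the remainder stays in front of `a`, and the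
        -- multiple of `d` crosses `a` as a multiple of `c`.
        refine .inr ⟨((n + s) % d).toNat, ?_, b c d ^ ((c : ℤ) * ((n + s) / d)) * z,
          mul_mem (b_zpow_mem_Q _) hz, ?_⟩
        · have := Int.emod_lt_of_pos (n + s) hd'
          lia
        · have e : b c d ^ ((n + s) % d).toNat = b c d ^ ((n + s) % d) := by
            rw [← zpow_natCast, Int.toNat_of_nonneg h0]
          rw [e, mul_assoc (b c d ^ ((n + s) % d)) (a c d), ← mul_assoc (a c d), ← b_zpow_mul_a]
          have e' : b c d ^ n * b c d ^ s =
              b c d ^ ((n + s) % d) * b c d ^ ((d : ℤ) * ((n + s) / d)) := by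
            rw [← zpow_add, Int.emod_add_mul_ediv, zpow_add, zpow_natCast]
          simp only [← mul_assoc, e']
    rcases hx with rfl | rfl | rfl
    · exact .inr ⟨0, hd, y, hy, by simp⟩
    · simpa using hb 1
    · simpa using hb (-1)

theorem height_nonneg_of_mem_Q {x : Grp c d} (hx : x ∈ Q c d) : 0 ≤ height (θ c d) x := by
  induction hx using Submonoid.closure_induction_left with
  | one => simp [height_one]
  | mul_left x hx y hy ih =>
    rw [height_mul]
    rcases hx with rfl | rfl | rfl <;> simp only [height_inv, height_a, height_b] <;> lia

theorem height_nonneg_of_mem {x : Grp c d} (hx : x ∈ P c d) : 0 ≤ height (θ c d) x :=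
  height_nonneg_of_mem_Q (P_le_Q hx)

theorem exists_b_zpow_of_height_eq_zero {x : Grp c d} (hd : 0 < d) (hx : x ∈ Q c d)
    (h : height (θ c d) x = 0) : ∃ m : ℤ, x = b c d ^ m := by
  rcases mem_Q_cases hd hx with h' | ⟨s, -, y, hy, rfl⟩
  · exact h'
  · have := height_nonneg_of_mem_Q hy
    simp only [height_mul, height_b_pow, height_a] at h
    lia

theorem exists_eq_of_height_pos {x : Grp c d} (hd : 0 < d) (hx : x ∈ P c d)
    (h : 0 < height (θ c d) x) : ∃ s < d, ∃ y ∈ P c d, x = b c d ^ s * a c d * y := by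
  rcases mem_P_cases hd hx with ⟨m, rfl⟩ | h'
  · simp at h
  · exact h'

theorem exists_b_pow_mul_mul_mem (hd : 0 < d) {x : Grp c d} (hx : x ∈ P c d) (m : ℕ) :
    ∃ n : ℕ, (b c d ^ m)⁻¹ * x * b c d ^ n ∈ P c d := by
  induction hx using Submonoid.closure_induction_left generalizing m with
  | one => exact ⟨m, by simp⟩
  | mul_left x hx y hy ih =>
    rcases hx with rfl | rfl
    · obtain ⟨n, hn⟩ := ih (c * m)
      refine ⟨n, ?_⟩
      -- Since `b^{-m} = b^{(d-1)m} b^{-dm}` and `b^{-dm} a = a b^{-cm}`, a negative power can be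
      -- pushed to the right of `a`, leaving only a nonnegative power behind.
      have e : (b c d ^ m)⁻¹ * (a c d * y) * b c d ^ n
          = b c d ^ ((d - 1) * m) * (a c d * ((b c d ^ (c * m))⁻¹ * y * b c d ^ n)) := by
        have h2 : b c d ^ (d * m) = b c d ^ m * b c d ^ ((d - 1) * m) := by
          rw [← pow_add]; congr 1; obtain ⟨e, rfl⟩ : ∃ e, d = e + 1 := ⟨d - 1, by lia⟩; simp; ring
        have h3 : b c d ^ ((d - 1) * m) * a c d = (b c d ^ m)⁻¹ * (a c d * b c d ^ (c * m)) := by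
          rw [← b_pow_mul_a, h2]; group
        simp only [← mul_assoc, h3]
        group
      rw [e]
      exact mul_mem (pow_mem b_mem _) (mul_mem a_mem hn)
    · cases m with
      | zero => exact ⟨0, by simpa using mul_mem b_mem hy⟩
      | succ m =>
        obtain ⟨n, hn⟩ := ih m
        refine ⟨n, ?_⟩
        convert hn using 1
        rw [pow_succ']
        group

/-- Negative powers of `b` can be pushed to the right end of a word and cancelled there. This
transfers common multiples in `Q` to upper bounds in `P`. -/
theorem exists_mul_b_pow_mem (hd : 0 < d) {x : Grp c d} (hx : x ∈ Q c d) :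
    ∃ n : ℕ, x * b c d ^ n ∈ P c d := by
  induction hx using Submonoid.closure_induction_left with
  | one => exact ⟨0, by simp⟩
  | mul_left x hx y hy ih =>
    obtain ⟨n, hn⟩ := ih
    rcases hx with rfl | rfl | rfl
    · exact ⟨n, by rw [mul_assoc]; exact mul_mem a_mem hn⟩
    · exact ⟨n, by rw [mul_assoc]; exact mul_mem b_mem hn⟩
    · obtain ⟨k, hk⟩ := exists_b_pow_mul_mul_mem hd hn 1
      exact ⟨n + k, by simpa [pow_add, mul_assoc] using hk⟩

/-! ### The normal form, in the HNN extension -/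

/-- The isomorphism `cℤ ≃ dℤ` that takes `c` to `d`. -/
noncomputable def powEquiv (hc : 0 < c) (hd : 0 < d) :
    (powMonoidHom c : Multiplicative ℤ →* Multiplicative ℤ).range ≃*
      (powMonoidHom d : Multiplicative ℤ →* Multiplicative ℤ).range :=
  (MonoidHom.ofInjective (pow_left_injective hc.ne')).symm.trans
    (MonoidHom.ofInjective (pow_left_injective hd.ne'))

theorem powEquiv_apply (hc : 0 < c) (hd : 0 < d) (x : Multiplicative ℤ) :
    (powEquiv hc hd ⟨x ^ c, x, rfl⟩ : Multiplicative ℤ) = x ^ d := by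
  have : (⟨x ^ c, x, rfl⟩ : (powMonoidHom c : Multiplicative ℤ →* Multiplicative ℤ).range) =
      MonoidHom.ofInjective (pow_left_injective hc.ne') x := rfl
  rw [this, powEquiv, MulEquiv.trans_apply, MulEquiv.symm_apply_apply]
  rfl

/-- The Baumslag–Solitar group maps to the corresponding HNN extension of `ℤ`. -/
noncomputable def toHNN (hc : 0 < c) (hd : 0 < d) :
    Grp c d →* HNNExtension (Multiplicative ℤ) _ _ (powEquiv hc hd) :=
  PresentedGroup.toGroup
    (f := fun s : Bool =>
      if s then HNNExtension.t else HNNExtension.of (Multiplicative.ofAdd 1)) (by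
      rintro r rfl
      have := HNNExtension.t_mul_of (φ := powEquiv hc hd) ⟨Multiplicative.ofAdd 1 ^ c, _, rfl⟩
      rw [powEquiv_apply] at this
      rw [map_mul, map_inv, mul_inv_eq_one]
      simpa using this)

theorem toHNN_a (hc : 0 < c) (hd : 0 < d) : toHNN hc hd (a c d) = HNNExtension.t := by
  simp [toHNN, a]

theorem toHNN_b (hc : 0 < c) (hd : 0 < d) :
    toHNN hc hd (b c d) = HNNExtension.of (Multiplicative.ofAdd 1) := by
  simp [toHNN, b]

theorem b_pow_ne_one (hc : 0 < c) (hd : 0 < d) {t : ℕ} (ht : 0 < t) : b c d ^ t ≠ 1 := by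
  intro h
  have h1 := congrArg (toHNN hc hd) h
  rw [map_pow, toHNN_b, ← map_pow, map_one (toHNN hc hd)] at h1
  have h2 := HNNExtension.of_injective (powEquiv hc hd) (h1.trans (map_one _).symm)
  have h3 := congrArg Multiplicative.toAdd h2
  simp at h3
  lia

-- Reducedness only restricts adjacent stable letters of opposite sign. Elements of `Q` need only
-- positive ones, so any word for them is already reduced.
open HNNExtension.NormalWord in
theorem exists_reducedWord (hc : 0 < c) (hd : 0 < d) {x : Grp c d} (hx : x ∈ Q c d) :
    ∃ w : ReducedWord (Multiplicative ℤ) (powMonoidHom c).range (powMonoidHom d).range,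
      w.prod (powEquiv hc hd) = toHNN hc hd x ∧ ∀ p ∈ w.toList, p.1 = 1 := by
  induction hx using Submonoid.closure_induction_left with
  | one => exact ⟨.empty _ _ _, by simp [ReducedWord.prod], by simp⟩
  | mul_left x hx y hy ih =>
    obtain ⟨w, hw, hp⟩ := ih
    rcases hx with rfl | rfl | rfl
    · refine ⟨⟨1, (1, w.head) :: w.toList, ?_⟩, ?_, by simpa using hp⟩
      · refine List.isChain_cons.2 ⟨fun q hq _ => ?_, w.chain⟩
        exact (hp q (List.mem_of_mem_head? hq)).symm
      · rw [map_mul, ← hw, toHNN_a]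
        simp [ReducedWord.prod, mul_assoc]
    · refine ⟨⟨Multiplicative.ofAdd 1 * w.head, w.toList, w.chain⟩, ?_, hp⟩
      rw [map_mul, ← hw, toHNN_b]
      simp [ReducedWord.prod, mul_assoc]
    · refine ⟨⟨(Multiplicative.ofAdd 1)⁻¹ * w.head, w.toList, w.chain⟩, ?_, hp⟩
      rw [map_mul, map_inv, ← hw, toHNN_b]
      simp only [ReducedWord.prod, map_mul, map_inv, mul_assoc]

open HNNExtension.NormalWord in
/-- The exponent in front of the first `a` is determined modulo `d`. -/
theorem dvd_sub_of_mul_eq (hc : 0 < c) (hd : 0 < d) {m n : ℤ} {y z : Grp c d}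
    (hy : y ∈ Q c d) (hz : z ∈ Q c d)
    (h : b c d ^ m * a c d * y = b c d ^ n * a c d * z) : (d : ℤ) ∣ n - m := by
  have key : ∀ (m : ℤ) {y : Grp c d}, y ∈ Q c d →
      ∃ w : ReducedWord (Multiplicative ℤ) (powMonoidHom c).range (powMonoidHom d).range,
        w.prod (powEquiv hc hd) = toHNN hc hd (b c d ^ m * a c d * y) ∧
        w.head = Multiplicative.ofAdd m ∧ w.toList.head?.map Prod.fst = some 1 := by
    intro m y hy
    obtain ⟨w, hw, hp⟩ := exists_reducedWord hc hd hy
    refine ⟨⟨Multiplicative.ofAdd m, (1, w.head) :: w.toList, ?_⟩, ?_, rfl, rfl⟩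
    · refine List.isChain_cons.2 ⟨fun q hq _ => ?_, w.chain⟩
      exact (hp q (List.mem_of_mem_head? hq)).symm
    · rw [map_mul, map_mul, map_zpow, ← hw, toHNN_a, toHNN_b, ← map_zpow]
      simp [ReducedWord.prod, mul_assoc, ← ofAdd_zsmul]
  obtain ⟨v, hv, hvh, hv1⟩ := key m hy
  obtain ⟨w, hw, hwh, hw1⟩ := key n hz
  -- Britton's lemma: equal products of reduced words starting with the same stable letter have
  -- heads in the same coset, here of `dℤ`.
  have := (HNNExtension.ReducedWord.map_fst_eq_and_of_prod_eq (powEquiv hc hd)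
    (hv.trans ((congrArg _ h).trans hw.symm))).2 1 (by rw [hv1]; rfl)
  rw [HNNExtension.toSubgroup_neg_one, hvh, hwh] at this
  obtain ⟨x, hx⟩ := this
  refine ⟨x.toAdd, ?_⟩
  have := congrArg Multiplicative.toAdd hx
  simp at this
  lia

theorem eq_of_mul_eq (hc : 0 < c) (hd : 0 < d) {s t : ℕ} (hs : s < d) (ht : t < d)
    {y z : Grp c d} (hy : y ∈ Q c d) (hz : z ∈ Q c d)
    (h : b c d ^ s * a c d * y = b c d ^ t * a c d * z) : s = t ∧ y = z := by
  have h1 : (d : ℤ) ∣ (t : ℤ) - s :=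
    dvd_sub_of_mul_eq hc hd hy hz (by simpa only [zpow_natCast] using h)
  have h2 : (t : ℤ) - s = 0 := by
    refine Int.eq_zero_of_abs_lt_dvd h1 ?_
    rw [abs_lt]; lia
  obtain rfl : s = t := by lia
  exact ⟨rfl, mul_left_cancel h⟩

/-! ### Least upper bounds -/

theorem mem_P_of_mul_mem (hc : 0 < c) (hd : 0 < d) {s : ℕ} (hs : s < d) {h : Grp c d}
    (hh : h ∈ Q c d) (hm : b c d ^ s * a c d * h ∈ P c d) : h ∈ P c d := by
  obtain ⟨t, ht, y, hy, e⟩ := exists_eq_of_height_pos hd hm (by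
    have := height_nonneg_of_mem_Q hh
    simp only [height_mul, height_b_pow, height_a]
    lia)
  rw [(eq_of_mul_eq hc hd hs ht hh (P_le_Q hy) e).2]
  exact hy

/-- Only the final exponent `m` of the normal form of `g` can obstruct membership in `P`, so `j =
max(0, -m)` works. Initial syllables `b^s a` are stripped by `mem_P_of_mul_mem`. -/
theorem exists_least_b_pow (hc : 0 < c) (hd : 0 < d) {g : Grp c d} (hg : g ∈ Q c d) :
    ∃ j : ℕ, g * b c d ^ j ∈ P c d ∧
      ∀ x ∈ P c d, g * x ∈ P c d → (b c d ^ j)⁻¹ * x ∈ P c d := by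
  obtain ⟨n, hn⟩ := Int.eq_ofNat_of_zero_le (height_nonneg_of_mem_Q hg)
  induction n generalizing g with
  | zero =>
    obtain ⟨m, rfl⟩ := exists_b_zpow_of_height_eq_zero hd hg hn
    rcases Int.eq_nat_or_neg m with ⟨k, rfl | rfl⟩
    · exact ⟨0, by simpa using pow_mem b_mem k, fun x hx _ => by simpa using hx⟩
    · exact ⟨k, by simp, fun x _ hx => by simpa using hx⟩
  | succ n ih =>
    rcases mem_Q_cases hd hg with ⟨m, rfl⟩ | ⟨s, hs, y, hy, rfl⟩
    · simp at hn; lia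
    · simp only [height_mul, height_b_pow, height_a] at hn
      obtain ⟨j, hj, hj'⟩ := ih hy (by lia)
      refine ⟨j, ?_, fun x hx hyx => hj' x hx ?_⟩
      · rw [mul_assoc]
        exact mul_mem (mul_mem (pow_mem b_mem _) a_mem) hj
      · rw [mul_assoc] at hyx
        exact mem_P_of_mul_mem hc hd hs (mul_mem hy (P_le_Q hx)) hyx

/-- By uniqueness of normal forms, a common multiple makes the syllables of `x` agree with the first
ones of `y`; they cancel in `x⁻¹ y` until only a power of `b` is left of `x`. -/
theorem inv_mul_mem_Q (hc : 0 < c) (hd : 0 < d) {x y p q : Grp c d} (hx : x ∈ P c d)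
    (hy : y ∈ P c d) (hp : p ∈ Q c d) (hq : q ∈ Q c d) (h : x * p = y * q)
    (hxy : height (θ c d) x ≤ height (θ c d) y) : x⁻¹ * y ∈ Q c d := by
  obtain ⟨n, hn⟩ := Int.eq_ofNat_of_zero_le (height_nonneg_of_mem hx)
  induction n generalizing x y with
  | zero =>
    obtain ⟨m, rfl⟩ := exists_b_zpow_of_height_eq_zero hd (P_le_Q hx) hn
    rw [← zpow_neg]
    exact mul_mem (b_zpow_mem_Q _) (P_le_Q hy)
  | succ n ih =>
    obtain ⟨s, hs, x, hx', rfl⟩ := exists_eq_of_height_pos hd hx (by lia)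
    obtain ⟨t, ht, y, hy', rfl⟩ := exists_eq_of_height_pos hd hy (by lia)
    simp only [height_mul, height_b_pow, height_a] at hn hxy
    rw [mul_assoc, mul_assoc (_ * _)] at h
    obtain ⟨rfl, h'⟩ :=
      eq_of_mul_eq hc hd hs ht (mul_mem (P_le_Q hx') hp) (mul_mem (P_le_Q hy') hq) h
    have := ih hx' hy' h' (by lia) (by lia)
    convert this using 1
    group

end Group

end BS

theorem IsJoin.symm {G : Type} [Group G] {P : Submonoid G} {x y z : G} (h : IsJoin P x y z) :
    IsJoin P y x z :=
  ⟨h.1, h.2.2.1, h.2.1, fun l hl h1 h2 => h.2.2.2 l hl h2 h1⟩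

theorem JoinFinite.symm {G : Type} [Group G] {P : Submonoid G} {x y : G} (h : JoinFinite P x y) :
    JoinFinite P y x :=
  let ⟨z, hz, h1, h2⟩ := h
  ⟨z, hz, h2, h1⟩

namespace BS

variable {c d : ℕ}

/-- Elements of `P` with a common upper bound in `P` have a least one. -/
theorem exists_isJoin (hc : 0 < c) (hd : 0 < d) {x y : Grp c d} (hx : x ∈ P c d) (hy : y ∈ P c d)
    (h : JoinFinite (P c d) x y) : ∃ z, IsJoin (P c d) x y z := by
  wlog hxy : height (θ c d) x ≤ height (θ c d) y generalizing x y
  · obtain ⟨z, hz⟩ := this hy hx h.symm (by lia)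
    exact ⟨z, hz.symm⟩
  obtain ⟨k, hk, h1, h2⟩ := h
  obtain ⟨j, hj, hj'⟩ := exists_least_b_pow hc hd
    (inv_mul_mem_Q hc hd hx hy (P_le_Q h1) (P_le_Q h2) (by simp) hxy)
  -- The join is the higher of the two elements times the least power of `b` that brings `x⁻¹ y`
  -- into `P`.
  refine ⟨y * b c d ^ j, mul_mem hy (pow_mem b_mem _), ?_, ?_, fun l hl hxl hyl => ?_⟩
  · simpa only [LeftLE, mul_assoc] using hj
  · simpa [LeftLE] using pow_mem b_mem j
  · have := hj' (y⁻¹ * l) hyl (by simpa [mul_assoc, LeftLE] using hxl)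
    simpa only [LeftLE, mul_inv_rev, mul_assoc] using this

end BS

/-! ### States -/

section States

variable {A : Type*} [CStarAlgebra A] {φ ψ : A →ₗ[ℂ] ℂ}

namespace IsState

theorem norm_sq_le (hφ : IsState φ) (a b : A) :
    ‖φ (star a * b)‖ ^ 2 ≤ (φ (star a * a)).re * (φ (star b * b)).re := by
  let _ : PartialOrder A := CStarAlgebra.spectralOrder A
  have _ : StarOrderedRing A := CStarAlgebra.spectralOrderedRing A
  let f : A →ₚ[ℂ] ℂ := PositiveLinearMap.mk₀ φ fun x hx => by
    obtain ⟨s, rfl⟩ := CStarAlgebra.nonneg_iff_eq_star_mul_self.1 hx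
    exact hφ.nonneg s
  have h := norm_inner_le_norm (𝕜 := ℂ) (f.toPreGNS a) (f.toPreGNS b)
  calc ‖φ (star a * b)‖ ^ 2 ≤ (√(φ (star a * a)).re * √(φ (star b * b)).re) ^ 2 :=
        pow_le_pow_left₀ (norm_nonneg _) h 2
    _ = _ := by
      rw [mul_pow, Real.sq_sqrt (Complex.nonneg_iff.1 (hφ.nonneg a)).1,
        Real.sq_sqrt (Complex.nonneg_iff.1 (hφ.nonneg b)).1]

/-- Polarisation: reality of `φ` at the squares of `1 + a` and `1 + ia` gives the imaginary and the
real part. -/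
theorem map_star (hφ : IsState φ) (a : A) : φ (star a) = star (φ a) := by
  have h1 := (Complex.nonneg_iff.1 (hφ.nonneg (1 + a))).2
  have h2 := (Complex.nonneg_iff.1 (hφ.nonneg (1 + Complex.I • a))).2
  have h0 := (Complex.nonneg_iff.1 (hφ.nonneg a)).2
  simp only [star_add, star_one, star_smul, mul_add, add_mul, one_mul, mul_one, map_add, map_smul,
    hφ.map_one, smul_mul_smul_comm, smul_eq_mul, Complex.star_def, Complex.conj_I, Complex.add_im,
    Complex.mul_im, Complex.neg_re, Complex.neg_im, Complex.I_re, Complex.I_im, Complex.one_im]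
    at h1 h2
  apply Complex.ext
  · simp at h1 h2 ⊢; linarith
  · simp at h1 h2 ⊢; linarith

theorem re_star_mul_self_le (hφ : IsState φ) (a : A) : (φ (star a * a)).re ≤ ‖a‖ ^ 2 := by
  let _ : PartialOrder A := CStarAlgebra.spectralOrder A
  have _ : StarOrderedRing A := CStarAlgebra.spectralOrderedRing A
  have h := sub_nonneg.2 (CStarAlgebra.star_mul_le_algebraMap_norm_sq (a := a))
  obtain ⟨s, hs⟩ := CStarAlgebra.nonneg_iff_eq_star_mul_self.1 h
  have h2 := (Complex.nonneg_iff.1 (hφ.nonneg s)).1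
  have h3 : algebraMap ℝ A (‖a‖ ^ 2) = ((‖a‖ ^ 2 : ℝ) : ℂ) • (1 : A) := by
    rw [Algebra.algebraMap_eq_smul_one, Complex.coe_smul]
  rw [← hs, h3, map_sub, map_smul, hφ.map_one, smul_eq_mul, mul_one, Complex.sub_re,
    Complex.ofReal_re] at h2
  linarith

theorem norm_le (hφ : IsState φ) (a : A) : ‖φ a‖ ≤ ‖a‖ := by
  have h := hφ.norm_sq_le 1 a
  rw [star_one, one_mul, one_mul, hφ.map_one, Complex.one_re, one_mul] at h
  exact le_of_sq_le_sq (h.trans (hφ.re_star_mul_self_le a)) (norm_nonneg _)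

theorem continuous (hφ : IsState φ) : Continuous φ :=
  AddMonoidHomClass.continuous_of_bound φ 1 fun a => by rw [one_mul]; exact hφ.norm_le a

theorem ext_of_dense (hφ : IsState φ) (hψ : IsState ψ) {D : Set A}
    (hD : Dense (Submodule.span ℂ D : Set A)) (h : ∀ a ∈ D, φ a = ψ a) : φ = ψ :=
  DFunLike.coe_injective <|
    hφ.continuous.ext_on hD hψ.continuous (LinearMap.eqOn_span' h)

theorem tendsto_of_dense {ι : Type*} {l : Filter ι} {φ : ι → A →ₗ[ℂ] ℂ} (hφ : ∀ i, IsState (φ i))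
    (hψ : IsState ψ) {D : Set A} (hD : Dense (Submodule.span ℂ D : Set A))
    (h : ∀ a ∈ D, Filter.Tendsto (fun i => φ i a) l (nhds (ψ a))) (a : A) :
    Filter.Tendsto (fun i => φ i a) l (nhds (ψ a)) := by
  have hspan : ∀ a ∈ Submodule.span ℂ D, Filter.Tendsto (fun i => φ i a) l (nhds (ψ a)) := by
    intro a ha
    induction ha using Submodule.span_induction with
    | mem a ha => exact h a ha
    | zero => simpa using tendsto_const_nhds
    | add a b _ _ ha hb => simpa using ha.add hb
    | smul z a _ ha => simpa using ha.const_mul z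
  refine Metric.tendsto_nhds.2 fun ε hε => ?_
  obtain ⟨b, hb, hab⟩ := hD.exists_dist_lt a (show 0 < ε / 3 by positivity)
  filter_upwards [Metric.tendsto_nhds.1 (hspan b hb) (ε / 3) (by positivity)] with i hi
  have h1 : dist (φ i a) (φ i b) ≤ dist a b := by
    rw [dist_eq_norm, dist_eq_norm, ← map_sub]; exact (hφ i).norm_le _
  have h2 : dist (ψ b) (ψ a) ≤ dist a b := by
    rw [dist_comm, dist_eq_norm, dist_eq_norm, ← map_sub]; exact hψ.norm_le _
  have := dist_triangle4 (φ i a) (φ i b) (ψ b) (ψ a)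
  linarith

/-- A limit point of a sequence of states. -/
theorem exists_tendsto_hyperfilter {φ : ℕ → A →ₗ[ℂ] ℂ} (hφ : ∀ n, IsState (φ n)) :
    ∃ ψ : A →ₗ[ℂ] ℂ, IsState ψ ∧
      ∀ a, Filter.Tendsto (fun n => φ n a) (Filter.hyperfilter ℕ) (nhds (ψ a)) := by
  have h : ∀ a, ∃ z, Filter.Tendsto (fun n => φ n a) (Filter.hyperfilter ℕ) (nhds z) := fun a => by
    -- The values at `a` stay in a compact disc, so they converge along the ultrafilter; linearity
    -- and positivity pass to the pointwise limit.
    obtain ⟨z, -, hz⟩ := (isCompact_closedBall (0 : ℂ) ‖a‖).ultrafilter_le_nhds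
      ((Filter.hyperfilter ℕ).map fun n => φ n a) (by
        rw [Filter.le_principal_iff]
        refine Filter.mem_map.2 (Filter.Eventually.of_forall fun n => ?_)
        simpa using (hφ n).norm_le a)
    exact ⟨z, hz⟩
  choose ψ hψ using h
  refine ⟨⟨⟨ψ, fun a b => ?_⟩, fun z a => ?_⟩, ⟨?_, fun a => ?_⟩, hψ⟩
  · exact tendsto_nhds_unique (hψ _) (by simpa using (hψ a).add (hψ b))
  · exact tendsto_nhds_unique (hψ _) (by simpa using (hψ a).const_mul z)
  · exact tendsto_nhds_unique (hψ _) (by simp [(hφ _).map_one])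
  · exact ge_of_tendsto' (hψ _) fun n => (hφ n).nonneg a

/-- A countable convex combination of states. -/
theorem exists_hasSum {φ : ℕ → A →ₗ[ℂ] ℂ} (hφ : ∀ n, IsState (φ n)) {w : ℕ → ℝ}
    (hw : ∀ n, 0 ≤ w n) (hw1 : HasSum w 1) :
    ∃ ψ : A →ₗ[ℂ] ℂ, IsState ψ ∧ ∀ a, HasSum (fun n => (w n : ℂ) * φ n a) (ψ a) := by
  have h : ∀ a, ∃ z, HasSum (fun n => (w n : ℂ) * φ n a) z := fun a => by
    refine Summable.of_norm_bounded (hw1.summable.mul_right ‖a‖) fun n => ?_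
    rw [norm_mul, Complex.norm_real, Real.norm_of_nonneg (hw n)]
    exact mul_le_mul_of_nonneg_left ((hφ n).norm_le a) (hw n)
  choose ψ hψ using h
  refine ⟨⟨⟨ψ, fun a b => ?_⟩, fun z a => ?_⟩, ⟨?_, fun a => ?_⟩, hψ⟩
  · exact (hψ _).unique (by simpa [mul_add] using (hψ a).add (hψ b))
  · exact (hψ _).unique (by simpa [mul_left_comm] using (hψ a).mul_left z)
  · exact (hψ _).unique (by simpa [(hφ _).map_one] using Complex.hasSum_ofReal.2 hw1)
  · exact (hψ _).nonneg fun n => mul_nonneg (by exact_mod_cast hw n) ((hφ n).nonneg a)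

end IsState

/-! ### A criterion for the KMS condition -/

theorem mul_eq_of_dense (hφ : IsState φ) {D : Set A} (hD : Dense (Submodule.span ℂ D : Set A))
    {z : ℂ} {b : A} (h : ∀ a ∈ D, φ (a * b) = z * φ (b * a)) (a : A) :
    φ (a * b) = z * φ (b * a) := by
  have hl : (φ ∘ₗ LinearMap.mulRight ℂ b : A → ℂ) =
      (z • φ ∘ₗ LinearMap.mulLeft ℂ b : A →ₗ[ℂ] ℂ) := by
    refine Continuous.ext_on hD ?_ ?_ (LinearMap.eqOn_span' fun a ha => ?_)
    · exact hφ.continuous.comp (continuous_mul_const b)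
    · exact (hφ.continuous.comp (continuous_const_mul b)).const_smul z
    · simpa using h a ha
  simpa using congrFun hl a

/-- A state is KMS if it is invariant and satisfies the KMS condition on a total set of homogeneous
elements. -/
theorem isKMS_of_dense {α : ℝ → A ≃⋆ₐ[ℂ] A} {β : ℝ} (hφ : IsState φ) {D : Set A}
    (hD : Dense (Submodule.span ℂ D : Set A))
    (h : ∀ b ∈ D, ∃ m : ℤ, (∀ t : ℝ, α t b = Complex.exp (Complex.I * t * m) • b) ∧
      (m ≠ 0 → φ b = 0) ∧ ∀ a ∈ D, φ (a * b) = Real.exp (β * m) * φ (b * a)) :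
    IsKMS α β φ := by
  refine ⟨hφ, fun a b F hF hFt => ?_⟩
  have hinv : ∀ t a, φ (α t a) = φ a := fun t => by
    have hc : Continuous (α t) :=
      AddMonoidHomClass.continuous_of_bound (α t) 1 fun a => by
        rw [one_mul]; exact NonUnitalStarAlgHom.norm_apply_le _ a
    have hl : (φ ∘ₗ (α t : A →ₐ[ℂ] A).toLinearMap : A → ℂ) = φ := by
      refine Continuous.ext_on hD (hφ.continuous.comp hc) hφ.continuous
        (LinearMap.eqOn_span' fun a ha => ?_)
      obtain ⟨m, h1, h2, -⟩ := h a ha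
      change φ (α t a) = φ a
      rw [h1, map_smul]
      by_cases hm : m = 0
      · simp [hm]
      · simp [h2 hm]
    exact fun a => congrFun hl a
  have hl : (φ ∘ₗ LinearMap.mulLeft ℂ a : A → ℂ) =
      (φ ∘ₗ LinearMap.mulRight ℂ (F (Complex.I * β)) : A →ₗ[ℂ] ℂ) := by
    refine Continuous.ext_on hD (hφ.continuous.comp (continuous_const_mul a))
      (hφ.continuous.comp (continuous_mul_const _)) (LinearMap.eqOn_span' fun b hb => ?_)
    obtain ⟨m, h1, -, h3⟩ := h b hb
    change φ (a * b) = φ (b * F (Complex.I * β))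
    rw [mul_eq_of_dense hφ hD h3]
    let L : A →L[ℂ] ℂ := ⟨φ, hφ.continuous⟩
    have hf : Differentiable ℂ fun z => φ (b * F z) :=
      L.differentiable.comp ((differentiable_const b).mul hF)
    have hg : Differentiable ℂ fun z => Complex.exp (-(Complex.I * z * m)) * φ (b * a) := by
      fun_prop
    -- Invariance of `φ` gives the identity for real `t`. Both sides are entire, so it also holds at
    -- `iβ`, where the factor is `e^{βm}`.
    have hreal : ∀ t : ℝ, φ (b * F t) = Complex.exp (-(Complex.I * t * m)) * φ (b * a) := by
      intro t
      have : b = Complex.exp (-(Complex.I * t * m)) • α t b := by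
        rw [h1, smul_smul, ← Complex.exp_add, neg_add_cancel, Complex.exp_zero, one_smul]
      rw [hFt]
      conv_lhs => rw [this]
      rw [smul_mul_assoc, map_smul, ← map_mul, hinv, smul_eq_mul]
    have hfg := AnalyticOnNhd.eq_of_frequently_eq (z₀ := 0)
      (fun z _ => hf.analyticAt z) (fun z _ => hg.analyticAt z) (by
        have ht : Filter.Tendsto (fun t : ℝ => (t : ℂ)) (nhdsWithin 0 {0}ᶜ)
            (nhdsWithin 0 {0}ᶜ) := by
          refine tendsto_nhdsWithin_iff.2 ⟨?_, ?_⟩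
          · simpa using (Complex.continuous_ofReal.tendsto 0).mono_left nhdsWithin_le_nhds
          · filter_upwards [self_mem_nhdsWithin] with t ht
            simpa using ht
        exact ht.frequently (Filter.Frequently.of_forall hreal))
    have := congrFun hfg (Complex.I * β)
    rw [this]
    congr 1
    rw [Complex.ofReal_exp]
    congr 1
    push_cast
    linear_combination ((β : ℂ) * m) * Complex.I_mul_I
  exact congrFun hl b

/-! ### States on quotients -/

/-- Cauchy–Schwarz gives `φ(pa) = 0`; the twisted trace property then turns `φ(bpa)` into a multiple
of `φ(pab) = 0`. The elements `x` with `φ(bxa) = 0` for all `a`, `b` form a two-sided ideal. -/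
theorem eq_zero_of_mem_closedIdeal (hφ : IsState φ) {D : Set A}
    (hD : Dense (Submodule.span ℂ D : Set A))
    (h : ∀ b ∈ D, ∃ z : ℂ, ∀ a, φ (b * a) = z * φ (a * b)) {p : A} (hp : star p * p = p)
    (hp0 : φ p = 0) {x : A} (hx : x ∈ closedIdeal p) : φ x = 0 := by
  have hps : star p = p := by rw [← hp, star_mul, star_star]
  have h1 : ∀ a, φ (p * a) = 0 := fun a => by
    have := hφ.norm_sq_le p a
    rw [hp, hp0, hps, Complex.zero_re, zero_mul] at this
    simpa using this
  have h2 : ∀ b a, φ (b * (p * a)) = 0 := fun b a => by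
    have hl : (φ ∘ₗ LinearMap.mulRight ℂ (p * a) : A → ℂ) = (0 : A →ₗ[ℂ] ℂ) := by
      refine Continuous.ext_on hD (hφ.continuous.comp (continuous_mul_const _)) continuous_const
        (LinearMap.eqOn_span' fun b hb => ?_)
      obtain ⟨z, hz⟩ := h b hb
      change φ (b * (p * a)) = 0
      rw [hz, mul_assoc, h1, mul_zero]
    exact congrFun hl b
  let J : TwoSidedIdeal A := TwoSidedIdeal.mk' {x | ∀ b a, φ (b * (x * a)) = 0}
    (by simp) (fun hx hy b a => by simp [add_mul, mul_add, hx b a, hy b a])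
    (fun hx b a => by simp [hx b a])
    (fun {x y} hy b a => by rw [mul_assoc, ← mul_assoc]; exact hy _ _)
    (fun {x y} hx b a => by rw [mul_assoc]; exact hx _ _)
  have hJ : TwoSidedIdeal.span {p} ≤ J := by
    rw [TwoSidedIdeal.span_le, Set.singleton_subset_iff]
    exact (TwoSidedIdeal.mem_mk' _ _ _ _ _ _ _).2 h2
  refine closure_minimal (s := {x | x ∈ TwoSidedIdeal.span {p}}) (t := {x | φ x = 0})
    (fun x hx => ?_) (isClosed_eq hφ.continuous continuous_const) hx
  have := (TwoSidedIdeal.mem_mk' _ _ _ _ _ _ _).1 (hJ hx) 1 1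
  simpa using this

theorem exists_state_quotient (hφ : IsState φ) {p : A} (h : ∀ x ∈ closedIdeal p, φ x = 0) :
    ∃ ψ : (A ⧸ closedIdeal p) →ₗ[ℂ] ℂ, IsState ψ ∧
      ∀ a, ψ (Ideal.Quotient.mk (closedIdeal p) a) = φ a := by
  have hf : ∀ x : A ⧸ closedIdeal p, ∃ z, ∀ a,
      Ideal.Quotient.mk (closedIdeal p) a = x → φ a = z := by
    intro x
    obtain ⟨b, rfl⟩ := Ideal.Quotient.mk_surjective x
    refine ⟨φ b, fun a ha => ?_⟩
    rw [← sub_eq_zero, ← map_sub]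
    exact h _ (Ideal.Quotient.eq.1 ha)
  choose ψ hψ using hf
  refine ⟨⟨⟨ψ, fun x y => ?_⟩, fun z x => ?_⟩, ⟨?_, fun x => ?_⟩, fun a => (hψ _ a rfl).symm⟩
  · obtain ⟨a, rfl⟩ := Ideal.Quotient.mk_surjective x
    obtain ⟨b, rfl⟩ := Ideal.Quotient.mk_surjective y
    rw [← hψ _ (a + b) (map_add _ _ _), ← hψ _ a rfl, ← hψ _ b rfl, map_add]
  · obtain ⟨a, rfl⟩ := Ideal.Quotient.mk_surjective x
    change ψ (z • _) = z * ψ _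
    rw [← hψ _ a rfl, ← hψ (z • _) (z • a) rfl, map_smul, smul_eq_mul]
  · exact (hψ _ 1 (map_one _)).symm.trans hφ.map_one
  · obtain ⟨a, rfl⟩ := Ideal.Quotient.mk_surjective x
    exact (hφ.nonneg a).trans_eq (hψ _ (star a * a) (map_mul _ _ _))

end States

/-- A homogeneous element is analytic: its orbit extends to `z ↦ e^{izm} b`, evaluated at `z = iβ`.
-/
theorem IsKMS.mul_comm_of_homogeneous {A : Type*} [CStarAlgebra A] {α : ℝ → A ≃⋆ₐ[ℂ] A} {β : ℝ}
    {φ : A →ₗ[ℂ] ℂ} (h : IsKMS α β φ) {b : A} {m : ℤ}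
    (hb : ∀ t : ℝ, α t b = Complex.exp (Complex.I * t * m) • b) (a : A) :
    φ (b * a) = Real.exp (-β * m) * φ (a * b) := by
  rw [h.kms b a (fun z => Complex.exp (Complex.I * z * m) • b)
    (by fun_prop) fun t => (hb t).symm, mul_smul_comm, map_smul, smul_eq_mul]
  congr 1
  rw [Complex.ofReal_exp]
  congr 1
  push_cast
  linear_combination ((β : ℂ) * m) * Complex.I_mul_I

/-! ### Products and density of the monomials `S_x S_y^*` -/

section Nica

variable {G : Type} [Group G] {P : Submonoid G} {A : Type*} [CStarAlgebra A] {S : P →* A}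

/-- The elements `S_x S_y^*`. -/
def monomials (S : P →* A) : Set A := {a | ∃ x y : P, a = S x * star (S y)}

/-- The state `φ` takes the value `e^{-βθ(x)}` at `S_x S_x^*` and vanishes at `S_x S_y^*` for
`x ≠ y`. -/
structure IsCanonical (θ : G →* Multiplicative ℤ) (S : P →* A) (β : ℝ) (φ : A →ₗ[ℂ] ℂ) :
    Prop where
  diag : ∀ x : P, φ (S x * star (S x)) = Real.exp (-β * height θ x)
  offDiag : ∀ x y : P, x ≠ y → φ (S x * star (S y)) = 0

theorem IsJoin.exists_eq_mul {x y z : G} (h : IsJoin P x y z) :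
    ∃ p r : P, z = x * p ∧ z = y * r :=
  ⟨⟨_, h.2.1⟩, ⟨_, h.2.2.1⟩, by simp, by simp⟩

namespace IsNicaCovariant

/-- Range projections can be inserted between `S_x^*` and `S_y` for free, and their product is the
range projection of the join `xp = yr`. -/
theorem star_mul_of_isJoin (hS : IsNicaCovariant P S) {x y p r : P}
    (h : IsJoin P (x : G) y (x * p : P)) (he : x * p = y * r) :
    star (S x) * S y = S p * star (S r) := by
  have h1 := hS.join x y _ h
  calc star (S x) * S y
      = star (S x) * (S x * star (S x) * (S y * star (S y))) * S y := by
        have : star (S x) * (S x * star (S x) * (S y * star (S y))) * S y =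
          (star (S x) * S x) * star (S x) * S y * (star (S y) * S y) := by noncomm_ring
        rw [this, hS.isometry, hS.isometry, one_mul, mul_one]
    _ = star (S x) * (S (x * p) * star (S (x * p))) * S y := by rw [h1]
    _ = star (S x) * (S (x * p) * star (S (y * r))) * S y := by rw [← he]
    _ = (star (S x) * S x) * S p * star (S r) * (star (S y) * S y) := by
        rw [map_mul, map_mul, star_mul]; noncomm_ring
    _ = _ := by rw [hS.isometry, hS.isometry, one_mul, mul_one]

theorem star_mul_of_not_joinFinite (hS : IsNicaCovariant P S) {x y : P}
    (h : ¬ JoinFinite P (x : G) y) : star (S x) * S y = 0 := by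
  calc star (S x) * S y
      = star (S x) * (S x * star (S x) * (S y * star (S y))) * S y := by
        have : star (S x) * (S x * star (S x) * (S y * star (S y))) * S y =
          (star (S x) * S x) * star (S x) * S y * (star (S y) * S y) := by noncomm_ring
        rw [this, hS.isometry, hS.isometry, one_mul, mul_one]
    _ = 0 := by rw [hS.disjoint x y h, mul_zero, zero_mul]

theorem monomial_mul (hS : IsNicaCovariant P S) (u : P) {v x : P} (y : P) {p r : P}
    (h : IsJoin P (v : G) x (v * p : P)) (he : v * p = x * r) :
    S u * star (S v) * (S x * star (S y)) = S (u * p) * star (S (y * r)) := by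
  rw [mul_assoc, ← mul_assoc (star (S v)), hS.star_mul_of_isJoin h he, map_mul, map_mul, star_mul]
  noncomm_ring

theorem star_mul_mul (hS : IsNicaCovariant P S) (x y : P) :
    star (S x) * S (x * y) = S y := by
  rw [map_mul, ← mul_assoc, hS.isometry, one_mul]

end IsNicaCovariant

/-- Any two elements of `P` with a common upper bound have a least one. -/
def HasJoins (P : Submonoid G) : Prop :=
  ∀ x y : P, JoinFinite P (x : G) y → ∃ z, IsJoin P (x : G) y z

theorem HasJoins.exists_mul (hP : HasJoins P) {x y : P} (h : JoinFinite P (x : G) y) :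
    ∃ p r : P, IsJoin P (x : G) y (x * p : P) ∧ x * p = y * r := by
  obtain ⟨z, hz⟩ := hP x y h
  obtain ⟨p, r, h1, h2⟩ := hz.exists_eq_mul
  exact ⟨p, r, by rw [Submonoid.coe_mul, ← h1]; exact hz, Subtype.ext (h1.symm.trans h2)⟩

theorem IsNicaCovariant.monomial_mul_mem (hS : IsNicaCovariant P S) (hP : HasJoins P)
    (u v x y : P) :
    S u * star (S v) * (S x * star (S y)) ∈ Submodule.span ℂ (monomials S) := by
  by_cases h : JoinFinite P (v : G) x
  · obtain ⟨p, r, h1, h2⟩ := hP.exists_mul h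
    exact Submodule.subset_span ⟨u * p, y * r, hS.monomial_mul u y h1 h2⟩
  · rw [mul_assoc, ← mul_assoc (star (S v)), hS.star_mul_of_not_joinFinite h, zero_mul, mul_zero]
    exact zero_mem _

theorem IsNicaCovariant.adjoin_le_span (hS : IsNicaCovariant P S) (hP : HasJoins P) {a : A}
    (ha : a ∈ StarAlgebra.adjoin ℂ (Set.range S)) : a ∈ Submodule.span ℂ (monomials S) := by
  induction ha using StarAlgebra.adjoin_induction with
  | mem a ha =>
    obtain ⟨x, rfl⟩ := ha
    exact Submodule.subset_span ⟨x, 1, by simp⟩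
  | algebraMap z =>
    rw [Algebra.algebraMap_eq_smul_one]
    exact Submodule.smul_mem _ _ (Submodule.subset_span ⟨1, 1, by simp⟩)
  | add a b _ _ ha hb => exact add_mem ha hb
  | mul a b h₁ h₂ ha hb =>
    clear h₁ h₂
    induction ha, hb using Submodule.span_induction₂ with
    | mem_mem a b ha hb =>
      obtain ⟨u, v, rfl⟩ := ha
      obtain ⟨x, y, rfl⟩ := hb
      exact hS.monomial_mul_mem hP u v x y
    | zero_left => simp
    | zero_right => simp
    | add_left a b c _ _ _ ha hb => rw [add_mul]; exact add_mem ha hb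
    | add_right a b c _ _ _ ha hb => rw [mul_add]; exact add_mem ha hb
    | smul_left z a b _ _ h => rw [smul_mul_assoc]; exact Submodule.smul_mem _ _ h
    | smul_right z a b _ _ h => rw [mul_smul_comm]; exact Submodule.smul_mem _ _ h
  | star a h₁ ha =>
    clear h₁
    induction ha using Submodule.span_induction with
    | mem a ha =>
      obtain ⟨x, y, rfl⟩ := ha
      exact Submodule.subset_span ⟨y, x, by simp⟩
    | zero => simp
    | add a b _ _ ha hb => rw [star_add]; exact add_mem ha hb
    | smul z a _ ha => rw [star_smul]; exact Submodule.smul_mem _ _ ha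

/-- The elements `T_x T_y^*` span a dense subspace of `C*(G, P)`. -/
theorem NicaAlg.dense_span (hP : HasJoins P) :
    Dense (Submodule.span ℂ (monomials (NicaAlg.T P)) : Set (NicaAlg P)) := by
  have hrep : IsNicaCovariant P (NicaProd.rep P) :=
    { isometry := fun x => congrArg (NicaAlg.incl P) ((NicaAlg.T_cov P).isometry x)
      join := fun x y z h => congrArg (NicaAlg.incl P) ((NicaAlg.T_cov P).join x y z h)
      disjoint := fun x y h => congrArg (NicaAlg.incl P) ((NicaAlg.T_cov P).disjoint x y h) }
  intro a
  refine (closure_subtype (p := fun f => f ∈ NicaProd.subalgebra P)).2 ?_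
  refine closure_mono (fun f hf => ?_) (show NicaAlg.incl P a ∈
    closure (StarAlgebra.adjoin ℂ (Set.range (NicaProd.rep P)) : Set (NicaProd P)) from a.2)
  have h := hrep.adjoin_le_span hP hf
  have hmap : Submodule.span ℂ (monomials (NicaProd.rep P)) ≤
      (Submodule.span ℂ (monomials (NicaAlg.T P))).map
        (NicaAlg.incl P : NicaAlg P →ₐ[ℂ] NicaProd P).toLinearMap := by
    rw [Submodule.map_span, Submodule.span_le]
    rintro _ ⟨x, y, rfl⟩
    exact Submodule.subset_span ⟨_, ⟨x, y, rfl⟩, rfl⟩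
  exact hmap h

/-! ### The KMS condition for canonical states -/

/-- The hypotheses say that `S_u S_v^* S_x S_y^*` is a diagonal monomial; the conclusion says so for
the product in the other order. The two least upper bounds make `r` and `p'` right multiples of each
other, so nonnegative heights force equality of theirs. -/
theorem exists_isJoin_swap (hP : HasJoins P) (θ : G →* Multiplicative ℤ)
    (hθ : ∀ x : P, 0 ≤ height θ x) {u v x y p r : P}
    (hj : IsJoin P (v : G) x (v * p : P)) (h1 : v * p = x * r) (h2 : u * p = y * r) :
    ∃ p' r' : P, IsJoin P (y : G) u (y * p' : P) ∧ y * p' = u * r' ∧ x * p' = v * r' ∧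
      height θ p' = height θ r := by
  have hyu : JoinFinite P (y : G) u :=
    ⟨(u * p : P), (u * p).2, by rw [h2]; simp [LeftLE], by simp [LeftLE]⟩
  obtain ⟨p', r', hj', h1'⟩ := hP.exists_mul hyu
  obtain ⟨s, hs⟩ : ∃ s : P, r = p' * s := by
    have := hj'.2.2.2 (y * r : P) (y * r).2 (by simp [LeftLE]) (by rw [← h2]; simp [LeftLE])
    refine ⟨⟨_, this⟩, Subtype.ext ?_⟩
    simp
  have hs' : p = r' * s := by
    have : u * p = u * (r' * s) := by rw [h2, hs, ← mul_assoc, h1', mul_assoc]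
    exact mul_left_cancel this
  have h2' : x * p' = v * r' := by
    have : x * p' * s = v * r' * s := by rw [mul_assoc, ← hs, ← h1, hs', mul_assoc]
    exact mul_right_cancel this
  obtain ⟨s', hs''⟩ : ∃ s' : P, p' = r * s' := by
    have := hj.2.2.2 (x * p' : P) (x * p').2 (by rw [h2']; simp [LeftLE]) (by simp [LeftLE])
    rw [h1] at this
    refine ⟨⟨_, this⟩, Subtype.ext ?_⟩
    simp
  refine ⟨p', r', hj', h1', h2', le_antisymm ?_ ?_⟩
  · rw [hs, Submonoid.coe_mul, height_mul]
    linarith [hθ s]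
  · rw [hs'', Submonoid.coe_mul, height_mul]
    linarith [hθ s']

namespace IsCanonical

variable {θ : G →* Multiplicative ℤ} {β : ℝ} {φ : A →ₗ[ℂ] ℂ}

theorem apply_mul_eq_zero (hS : IsNicaCovariant P S) (hP : HasJoins P) (h : IsCanonical θ S β φ)
    {u v x y : P}
    (hn : ¬ ∃ p r : P, IsJoin P (v : G) x (v * p : P) ∧ v * p = x * r ∧ u * p = y * r) :
    φ (S u * star (S v) * (S x * star (S y))) = 0 := by
  by_cases hf : JoinFinite P (v : G) x
  · obtain ⟨p, r, h1, h2⟩ := hP.exists_mul hf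
    have := h.offDiag (u * p) (y * r) fun h3 => hn ⟨p, r, h1, h2, h3⟩
    rw [← this, hS.monomial_mul u y h1 h2]
  · rw [mul_assoc, ← mul_assoc (star (S v)), hS.star_mul_of_not_joinFinite hf, zero_mul, mul_zero,
      map_zero]

theorem apply_mul_eq (hS : IsNicaCovariant P S) (h : IsCanonical θ S β φ)
    {u v x y p r : P} (h1 : IsJoin P (v : G) x (v * p : P)) (h2 : v * p = x * r)
    (h3 : u * p = y * r) :
    φ (S u * star (S v) * (S x * star (S y))) = Real.exp (-β * (height θ y + height θ r)) := by
  have := h.diag (y * r)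
  rw [Submonoid.coe_mul, height_mul, Int.cast_add] at this
  rw [← this, hS.monomial_mul u y h1 h2, h3]

theorem mul_comm_monomial (hS : IsNicaCovariant P S) (hP : HasJoins P)
    (hθ : ∀ x : P, 0 ≤ height θ x) (h : IsCanonical θ S β φ) (u v x y : P) :
    φ (S u * star (S v) * (S x * star (S y))) =
      Real.exp (β * (height θ x - height θ y : ℤ)) *
        φ (S x * star (S y) * (S u * star (S v))) := by
  by_cases hE : ∃ p r : P, IsJoin P (v : G) x (v * p : P) ∧ v * p = x * r ∧ u * p = y * r
  · obtain ⟨p, r, h1, h2, h3⟩ := hE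
    obtain ⟨p', r', h1', h2', h3', hh⟩ := exists_isJoin_swap hP θ hθ h1 h2 h3
    rw [h.apply_mul_eq hS h1 h2 h3, h.apply_mul_eq hS h1' h2' h3', ← Complex.ofReal_mul,
      ← Real.exp_add]
    have e : height θ x + height θ p' = height θ v + height θ r' := by
      have := congrArg (fun z : P => height θ z) h3'
      simpa only [Submonoid.coe_mul, height_mul] using this
    have e' : (height θ x : ℝ) + height θ p' = height θ v + height θ r' := by exact_mod_cast e
    rw [hh] at e'
    rw [← e']
    congr 2
    push_cast
    ring
  · rw [h.apply_mul_eq_zero hS hP hE, h.apply_mul_eq_zero hS hP, mul_zero]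
    rintro ⟨p, r, h1, h2, h3⟩
    obtain ⟨p', r', h1', h2', h3', -⟩ := exists_isJoin_swap hP θ hθ h1 h2 h3
    exact hE ⟨p', r', h1', h2', h3'⟩

theorem isKMS (hS : IsNicaCovariant P S) (hP : HasJoins P) (hθ : ∀ x : P, 0 ≤ height θ x)
    (h : IsCanonical θ S β φ) (hφ : IsState φ)
    (hD : Dense (Submodule.span ℂ (monomials S) : Set A))
    {α : ℝ → A ≃⋆ₐ[ℂ] A} (hα : ∀ t x, α t (S x) = phase θ t x • S x) : IsKMS α β φ := by
  refine isKMS_of_dense hφ hD ?_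
  rintro _ ⟨x, y, rfl⟩
  refine ⟨height θ x - height θ y, fun t => ?_, fun hm => ?_, ?_⟩
  · rw [map_mul, map_star, hα, hα, star_smul, smul_mul_smul_comm]
    congr 1
    simp only [phase, Complex.star_def, ← Complex.exp_conj, ← Complex.exp_add]
    congr 1
    simp
    ring
  · exact h.offDiag x y fun e => hm (by rw [e, sub_self])
  · rintro _ ⟨u, v, rfl⟩
    exact h.mul_comm_monomial hS hP hθ u v x y

theorem ext (h : IsCanonical θ S β φ) {ψ : A →ₗ[ℂ] ℂ} (hφ : IsState φ) (hψ : IsState ψ)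
    (hD : Dense (Submodule.span ℂ (monomials S) : Set A)) (h' : IsCanonical θ S β ψ) : φ = ψ := by
  refine hφ.ext_of_dense hψ hD ?_
  rintro _ ⟨x, y, rfl⟩
  by_cases hxy : x = y
  · rw [hxy, h.diag, h'.diag]
  · rw [h.offDiag x y hxy, h'.offDiag x y hxy]

end IsCanonical

end Nica

/-! ### Isometries of `ℓ²` induced by injections -/

section Shift

variable {X : Type*}

open Classical in
theorem orthogonalFamily_single {f : X → X} (hf : Function.Injective f) :
    OrthogonalFamily ℂ (fun _ : X => ℂ) fun x =>
      (⟨lp.lsingle (𝕜 := ℂ) (E := fun _ : X => ℂ) 2 (f x),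
        fun z => lp.norm_single (E := fun _ : X => ℂ) (by norm_num) (f x) z⟩ :
          ℂ →ₗᵢ[ℂ] lp (fun _ : X => ℂ) 2) := by
  intro x y hxy z w
  change inner ℂ (lp.single (E := fun _ : X => ℂ) 2 (f x) z) (lp.single 2 (f y) w) = 0
  rw [lp.inner_single_left, lp.single_apply_ne _ _ _ (hf.ne hxy), inner_zero_right]

/-- The isometry of `ℓ²(X)` that takes the basis vector at `x` to the one at `f x`. -/
noncomputable def shift {f : X → X} (hf : Function.Injective f) :
    lp (fun _ : X => ℂ) 2 →L[ℂ] lp (fun _ : X => ℂ) 2 :=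
  (orthogonalFamily_single hf).linearIsometry.toContinuousLinearMap

theorem star_shift_mul_shift {f : X → X} (hf : Function.Injective f) :
    star (shift hf) * shift hf = 1 :=
  (ContinuousLinearMap.norm_map_iff_adjoint_comp_self _).1
    (orthogonalFamily_single hf).linearIsometry.norm_map

open Classical in
theorem shift_single {f : X → X} (hf : Function.Injective f) (x : X) :
    shift hf (lp.single 2 x 1) = lp.single (E := fun _ : X => ℂ) 2 (f x) 1 :=
  (orthogonalFamily_single hf).linearIsometry_apply_single (1 : ℂ)

/-- The adjoint is composition with `f`, a formula valid at every coordinate; operator identities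
are therefore easier to check on adjoints. -/
theorem star_shift_apply {f : X → X} (hf : Function.Injective f) (v : lp (fun _ : X => ℂ) 2)
    (x : X) : star (shift hf) v x = v (f x) := by
  classical
  have h1 := lp.inner_single_left (𝕜 := ℂ) (G := fun _ : X => ℂ) x 1 (star (shift hf) v)
  have h2 := lp.inner_single_left (𝕜 := ℂ) (G := fun _ : X => ℂ) (f x) 1 v
  rw [ContinuousLinearMap.star_eq_adjoint, ContinuousLinearMap.adjoint_inner_right, shift_single,
    h2, ← ContinuousLinearMap.star_eq_adjoint] at h1
  simpa using h1.symm

theorem shift_apply_apply {f : X → X} (hf : Function.Injective f) (v : lp (fun _ : X => ℂ) 2)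
    (x : X) : shift hf v (f x) = v x := by
  rw [← star_shift_apply hf, ← mul_apply_eq_comp, star_shift_mul_shift,
    one_apply_eq_self]

theorem shift_apply_of_notMem {f : X → X} (hf : Function.Injective f)
    (v : lp (fun _ : X => ℂ) 2) {y : X} (hy : y ∉ Set.range f) : shift hf v y = 0 := by
  classical
  have h1 := lp.inner_single_left (𝕜 := ℂ) (G := fun _ : X => ℂ) y 1 (shift hf v)
  have h2 : star (shift hf) (lp.single (E := fun _ : X => ℂ) 2 y 1) = 0 := by
    ext x
    rw [star_shift_apply, lp.single_apply_ne _ _ _ (fun h => hy ⟨x, h⟩)]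
    rfl
  rw [← ContinuousLinearMap.adjoint_inner_left, ← ContinuousLinearMap.star_eq_adjoint, h2,
    inner_zero_left] at h1
  simpa using h1.symm

open Classical in
theorem shift_mul_star_apply {f : X → X} (hf : Function.Injective f)
    (v : lp (fun _ : X => ℂ) 2) (y : X) :
    (shift hf * star (shift hf)) v y = if y ∈ Set.range f then v y else 0 := by
  rw [mul_apply_eq_comp]
  split_ifs with h
  · obtain ⟨x, rfl⟩ := h
    rw [shift_apply_apply, star_shift_apply]
  · rw [shift_apply_of_notMem hf _ h]

theorem shift_mul_shift {f g h : X → X} (hf : Function.Injective f) (hg : Function.Injective g)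
    (hh : Function.Injective h) (e : ∀ x, h x = f (g x)) : shift hh = shift hf * shift hg := by
  apply star_injective
  ext v x
  rw [star_mul, mul_apply_eq_comp, star_shift_apply, star_shift_apply,
    star_shift_apply, e]

theorem shift_eq_one {f : X → X} (hf : Function.Injective f) (e : ∀ x, f x = x) :
    shift hf = 1 := by
  apply star_injective
  ext v x
  rw [star_shift_apply, e, star_one, one_apply_eq_self]

open Classical in
theorem inner_single_shift [DecidableEq X] {f g : X → X} (hf : Function.Injective f)
    (hg : Function.Injective g) (x : X) :
    inner ℂ (lp.single (E := fun _ : X => ℂ) 2 x 1)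
      ((shift hf * star (shift hg)) (lp.single 2 x 1)) =
      if ∃ y, f y = x ∧ g y = x then 1 else 0 := by
  rw [lp.inner_single_left, mul_apply_eq_comp]
  by_cases hx : x ∈ Set.range f
  · obtain ⟨y, rfl⟩ := hx
    rw [shift_apply_apply, star_shift_apply]
    by_cases h : g y = f y
    · rw [if_pos ⟨y, rfl, h⟩, h]
      simp
    · rw [if_neg, lp.single_apply_ne _ _ _ h, inner_zero_right]
      rintro ⟨z, h1, h2⟩
      exact h (hf h1 ▸ h2)
  · rw [shift_apply_of_notMem hf _ hx, inner_zero_right, if_neg]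
    exact fun ⟨y, h1, _⟩ => hx ⟨y, h1⟩

end Shift

namespace BS

variable {c d : ℕ}

/-! ### The representation on `ℓ²(Q)` -/

/-- Left multiplication by an element of `P` on `Q`. -/
def mulQ (x : P c d) (g : Q c d) : Q c d := ⟨x * g, mul_mem (P_le_Q x.2) g.2⟩

theorem mulQ_injective (x : P c d) : Function.Injective (mulQ x) := fun _ _ h =>
  Subtype.ext (mul_left_cancel (congrArg Subtype.val h))

theorem mem_range_mulQ {x : P c d} {g : Q c d} :
    g ∈ Set.range (mulQ x) ↔ (x : Grp c d)⁻¹ * g ∈ Q c d := by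
  constructor
  · rintro ⟨h, rfl⟩
    simp [mulQ]
  · exact fun h => ⟨⟨_, h⟩, Subtype.ext (by simp [mulQ])⟩

/-- The operators `e_g ↦ e_{xg}` on `ℓ²(Q)`. -/
noncomputable def shiftHom :
    P c d →* (lp (fun _ : Q c d => ℂ) 2 →L[ℂ] lp (fun _ : Q c d => ℂ) 2) where
  toFun x := shift (mulQ_injective x)
  map_one' := shift_eq_one _ fun g => Subtype.ext (by simp [mulQ])
  map_mul' x y := shift_mul_shift _ _ _ fun g => Subtype.ext (by simp [mulQ, mul_assoc])

theorem joinFinite_of_mem_range (hd : 0 < d) {x y : P c d} {g : Q c d}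
    (hx : g ∈ Set.range (mulQ x)) (hy : g ∈ Set.range (mulQ y)) :
    ∃ n : ℕ, (g * b c d ^ n : Grp c d) ∈ P c d ∧ LeftLE (P c d) (x : Grp c d) (g * b c d ^ n) ∧
      LeftLE (P c d) (y : Grp c d) (g * b c d ^ n) := by
  obtain ⟨m, hm⟩ := exists_mul_b_pow_mem hd (mem_range_mulQ.1 hx)
  obtain ⟨n, hn⟩ := exists_mul_b_pow_mem hd (mem_range_mulQ.1 hy)
  have h1 : LeftLE (P c d) (x : Grp c d) (g * b c d ^ (m + n)) := by
    simpa [LeftLE, pow_add, mul_assoc] using mul_mem hm (pow_mem b_mem n)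
  have h2 : LeftLE (P c d) (y : Grp c d) (g * b c d ^ (m + n)) := by
    rw [add_comm m n]
    simpa [LeftLE, pow_add, mul_assoc] using mul_mem hn (pow_mem b_mem m)
  refine ⟨m + n, ?_, h1, h2⟩
  simpa using mul_mem x.2 h1

/-- Range projections are multiplications by indicators of the sets `xQ`, so covariance amounts to
`xQ ∩ yQ = zQ` for a join `z`, and `xQ ∩ yQ = ∅` without one. If `g` lies in both sets, some `g b^n`
is a common upper bound in `P`, and `b^{-n}` is available in `Q`. -/
theorem shiftHom_cov (hd : 0 < d) : IsNicaCovariant (P c d) (shiftHom (c := c) (d := d)) where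
  isometry x := star_shift_mul_shift (mulQ_injective x)
  join x y z hz := by
    ext v g
    change (shift (mulQ_injective x) * star (shift (mulQ_injective x)))
      ((shift (mulQ_injective y) * star (shift (mulQ_injective y))) v) g =
      (shift (mulQ_injective z) * star (shift (mulQ_injective z))) v g
    simp only [shift_mul_star_apply]
    have h : g ∈ Set.range (mulQ z) ↔ g ∈ Set.range (mulQ x) ∧ g ∈ Set.range (mulQ y) := by
      constructor
      · rintro ⟨k, rfl⟩
        simp only [mem_range_mulQ, mulQ, ← mul_assoc]
        exact ⟨mul_mem (P_le_Q hz.2.1) k.2, mul_mem (P_le_Q hz.2.2.1) k.2⟩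
      · rintro ⟨hx, hy⟩
        obtain ⟨n, h0, h1, h2⟩ := joinFinite_of_mem_range hd hx hy
        have := hz.2.2.2 _ h0 h1 h2
        rw [mem_range_mulQ]
        have h3 := mul_mem (P_le_Q this) (b_zpow_mem_Q (-n : ℤ))
        simpa [mul_assoc] using h3
    by_cases hx : g ∈ Set.range (mulQ x) <;> by_cases hy : g ∈ Set.range (mulQ y) <;>
      simp only [h, hx, hy, if_true, if_false, and_self, and_true, true_and]
  disjoint x y h := by
    ext v g
    change (shift (mulQ_injective x) * star (shift (mulQ_injective x)))
      ((shift (mulQ_injective y) * star (shift (mulQ_injective y))) v) g = 0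
    simp only [shift_mul_star_apply]
    by_cases hx : g ∈ Set.range (mulQ x) <;> by_cases hy : g ∈ Set.range (mulQ y) <;>
      simp only [hx, hy, if_true, if_false]
    obtain ⟨n, h0, h1, h2⟩ := joinFinite_of_mem_range hd hx hy
    exact absurd ⟨_, h0, h1, h2⟩ h

open Classical in
instance nontrivial_lp : Nontrivial (lp (fun _ : Q c d => ℂ) 2) :=
  ⟨⟨lp.single 2 1 1, 0, fun h => by
    have := congrArg (fun v : lp (fun _ : Q c d => ℂ) 2 => v 1) h
    simp at this⟩⟩

/-- The representation of `P` on `ℓ²(Q)`. -/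
noncomputable def shiftRep (hd : 0 < d) : NicaRep (P c d) where
  B := lp (fun _ : Q c d => ℂ) 2 →L[ℂ] lp (fun _ : Q c d => ℂ) 2
  S := shiftHom
  cov := shiftHom_cov hd

/-! ### Averages of vector states -/

open Classical in
/-- The vector state of the basis vector at `g`. -/
noncomputable def vectorState (hd : 0 < d) (g : Q c d) : Toeplitz c d →ₗ[ℂ] ℂ :=
  (innerₛₗ ℂ (lp.single (E := fun _ : Q c d => ℂ) 2 g 1)) ∘ₗ
    (ContinuousLinearMap.apply ℂ _ (lp.single (E := fun _ : Q c d => ℂ) 2 g 1)).toLinearMap ∘ₗ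
    (NicaAlg.lift (P c d) (shiftRep hd) : Toeplitz c d →ₐ[ℂ] (shiftRep hd).B).toLinearMap

open Classical in
theorem vectorState_apply (hd : 0 < d) (g : Q c d) (x : Toeplitz c d) :
    vectorState hd g x = inner ℂ (lp.single (E := fun _ : Q c d => ℂ) 2 g 1)
      ((show lp (fun _ : Q c d => ℂ) 2 →L[ℂ] lp (fun _ : Q c d => ℂ) 2 from
        NicaAlg.lift (P c d) (shiftRep hd) x) (lp.single 2 g 1)) := rfl

-- A nonzero `S_x S_y^* e_g` is `e_{xk}` with `g = yk`. It has a component along `e_g` only if `xk =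
-- yk`, which cancels to `x = y`.
open Classical in
theorem vectorState_monomial (hd : 0 < d) (g : Q c d) (x y : P c d) :
    vectorState hd g (T c d x * star (T c d y)) =
      if x = y ∧ (x : Grp c d)⁻¹ * g ∈ Q c d then 1 else 0 := by
  rw [vectorState_apply, map_mul, map_star]
  have key : (∃ k, mulQ x k = g ∧ mulQ y k = g) ↔ x = y ∧ (x : Grp c d)⁻¹ * g ∈ Q c d := by
    constructor
    · rintro ⟨k, h1, h2⟩
      refine ⟨Subtype.ext (mul_right_cancel (b := (k : Grp c d)) ?_), mem_range_mulQ.1 ⟨k, h1⟩⟩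
      exact congrArg Subtype.val (h1.trans h2.symm)
    · rintro ⟨rfl, h⟩
      obtain ⟨k, hk⟩ := mem_range_mulQ.2 h
      exact ⟨k, hk, hk⟩
  rw [← if_congr key rfl rfl]
  exact inner_single_shift (mulQ_injective x) (mulQ_injective y) g

theorem isState_vectorState (hd : 0 < d) (g : Q c d) : IsState (vectorState hd g) where
  map_one := by
    classical
    rw [vectorState_apply, map_one]
    change inner ℂ _ (lp.single (E := fun _ : Q c d => ℂ) 2 g 1) = 1
    rw [lp.inner_single_left]
    simp
  nonneg x := by
    classical
    rw [vectorState_apply, map_mul, map_star]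
    change 0 ≤ inner ℂ _ ((star (show lp (fun _ : Q c d => ℂ) 2 →L[ℂ] lp (fun _ : Q c d => ℂ) 2 from
      NicaAlg.lift (P c d) (shiftRep hd) x)) _)
    rw [ContinuousLinearMap.star_eq_adjoint, ContinuousLinearMap.adjoint_inner_right]
    exact (RCLike.nonneg_iff (K := ℂ)).2 ⟨inner_self_nonneg, inner_self_im _⟩

/-- The average of the vector states at `g σ`, where `σ` runs over the products of `n` factors
`b^j a` with `0 ≤ j < d`. -/
noncomputable def avgState (hd : 0 < d) : ℕ → Q c d → Toeplitz c d →ₗ[ℂ] ℂ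
  | 0, g => vectorState hd g
  | n + 1, g => (d : ℂ)⁻¹ • ∑ j ∈ Finset.range d,
      avgState hd n (g * ⟨b c d ^ j * a c d, mul_mem (pow_mem b_mem_Q j) a_mem_Q⟩)

theorem isState_avgState (hd : 0 < d) (n : ℕ) (g : Q c d) : IsState (avgState hd n g) := by
  have hd' : (d : ℂ) ≠ 0 := by exact_mod_cast hd.ne'
  induction n generalizing g with
  | zero => exact isState_vectorState hd g
  | succ n ih =>
    refine ⟨?_, fun x => ?_⟩
    · simp [avgState, (ih _).map_one, hd']
    · simp only [avgState, LinearMap.smul_apply, LinearMap.sum_apply, smul_eq_mul]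
      exact mul_nonneg (by simp) (Finset.sum_nonneg fun j _ => (ih _).nonneg x)

theorem avgState_offDiag (hd : 0 < d) (n : ℕ) (g : Q c d) {x y : P c d} (h : x ≠ y) :
    avgState hd n g (T c d x * star (T c d y)) = 0 := by
  induction n generalizing g with
  | zero => rw [avgState, vectorState_monomial, if_neg fun e => h e.1]
  | succ n ih => simp [avgState, ih]

theorem avgState_diag_eq_one (hd : 0 < d) (n : ℕ) {g : Q c d} {x : P c d}
    (h : (x : Grp c d)⁻¹ * g ∈ Q c d) : avgState hd n g (T c d x * star (T c d x)) = 1 := by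
  have hd' : (d : ℂ) ≠ 0 := by exact_mod_cast hd.ne'
  induction n generalizing g with
  | zero => rw [avgState, vectorState_monomial, if_pos ⟨rfl, h⟩]
  | succ n ih =>
    have : ∀ j, avgState hd n (g * ⟨b c d ^ j * a c d, mul_mem (pow_mem b_mem_Q j) a_mem_Q⟩)
        (T c d x * star (T c d x)) = 1 := fun j => ih (by
      rw [Submonoid.coe_mul, ← mul_assoc]
      exact mul_mem h (mul_mem (pow_mem b_mem_Q j) a_mem_Q))
    simp [avgState, this, hd']

theorem avgState_diag_eq_zero (hd : 0 < d) (n : ℕ) {g : Q c d} {x : P c d}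
    (h : ∀ k ∈ Q c d, (x : Grp c d)⁻¹ * g * k ∉ Q c d) :
    avgState hd n g (T c d x * star (T c d x)) = 0 := by
  induction n generalizing g with
  | zero =>
    rw [avgState, vectorState_monomial, if_neg]
    exact fun e => h 1 (one_mem _) (by simpa using e.2)
  | succ n ih =>
    have : ∀ j, avgState hd n (g * ⟨b c d ^ j * a c d, mul_mem (pow_mem b_mem_Q j) a_mem_Q⟩)
        (T c d x * star (T c d x)) = 0 := fun j => ih (fun k hk => by
      have := h _ (mul_mem (mul_mem (pow_mem b_mem_Q j) a_mem_Q) hk)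
      simpa only [Submonoid.coe_mul, mul_assoc] using this)
    simp [avgState, this]

/-- The value depends only on `x⁻¹ g`. -/
theorem avgState_diag_congr (hd : 0 < d) (n : ℕ) {g h : Q c d} {x y : P c d}
    (e : (x : Grp c d)⁻¹ * g = (y : Grp c d)⁻¹ * h) :
    avgState hd n g (T c d x * star (T c d x)) = avgState hd n h (T c d y * star (T c d y)) := by
  induction n generalizing g h with
  | zero =>
    rw [avgState, avgState, vectorState_monomial, vectorState_monomial]
    by_cases hm : (y : Grp c d)⁻¹ * h ∈ Q c d
    · rw [if_pos ⟨rfl, e ▸ hm⟩, if_pos ⟨rfl, hm⟩]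
    · rw [if_neg fun h' => hm (e ▸ h'.2), if_neg fun h' => hm h'.2]
  | succ n ih =>
    simp only [avgState, LinearMap.smul_apply, LinearMap.sum_apply]
    congr 1
    refine Finset.sum_congr rfl fun j _ => ih ?_
    simp only [Submonoid.coe_mul, ← mul_assoc, e]

/-- The value is the proportion of words `σ` of `n` syllables with `x⁻¹ σ ∈ Q`, that is, whose first
`θ(x)` syllables are those of `x`. -/
theorem avgState_diag (hc : 0 < c) (hd : 0 < d) (n : ℕ) (x : P c d) :
    avgState hd n 1 (T c d x * star (T c d x)) =
      if height (θ c d) x ≤ n then ((d : ℂ) ^ height (θ c d) x)⁻¹ else 0 := by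
  induction n generalizing x with
  | zero =>
    rw [avgState, vectorState_monomial]
    have h0 := height_nonneg_of_mem x.2
    by_cases h : height (θ c d) x = 0
    · obtain ⟨m, hm⟩ := exists_b_zpow_of_height_eq_zero hd (P_le_Q x.2) h
      rw [if_pos, if_pos (by simp [h]), h]
      · simp
      · refine ⟨rfl, ?_⟩
        rw [hm, ← zpow_neg, Submonoid.coe_one, mul_one]
        exact b_zpow_mem_Q _
    · rw [if_neg, if_neg (by simp; lia)]
      rintro ⟨-, hx⟩
      have := height_nonneg_of_mem_Q hx
      rw [Submonoid.coe_one, mul_one, height_inv] at this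
      lia
  | succ n ih =>
    have h0 := height_nonneg_of_mem x.2
    have hd' : (d : ℂ) ≠ 0 := by exact_mod_cast hd.ne'
    by_cases h : height (θ c d) x = 0
    · obtain ⟨m, hm⟩ := exists_b_zpow_of_height_eq_zero hd (P_le_Q x.2) h
      rw [avgState_diag_eq_one, if_pos (by rw [h]; positivity), h]
      · simp
      · rw [hm, ← zpow_neg, Submonoid.coe_one, mul_one]
        exact b_zpow_mem_Q _
    · obtain ⟨i, hi, y, hy, e⟩ := exists_eq_of_height_pos hd x.2 (by lia)
      -- A wrong first syllable cannot be repaired by any continuation of the word; only `j = i`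
      -- contributes.
      have hz : ∀ j ∈ Finset.range d, j ≠ i →
          avgState hd n (1 * ⟨b c d ^ j * a c d, mul_mem (pow_mem b_mem_Q j) a_mem_Q⟩)
            (T c d x * star (T c d x)) = 0 := by
        intro j hj hji
        refine avgState_diag_eq_zero hd n fun k hk hm => hji ?_
        refine (eq_of_mul_eq hc hd (Finset.mem_range.1 hj) hi hk (mul_mem (P_le_Q hy) hm) ?_).1
        rw [← mul_assoc, ← e]
        simp [mul_assoc]
      have hi' : avgState hd n (1 * ⟨b c d ^ i * a c d, mul_mem (pow_mem b_mem_Q i) a_mem_Q⟩)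
            (T c d x * star (T c d x)) =
          avgState hd n 1 (T c d ⟨y, hy⟩ * star (T c d ⟨y, hy⟩)) :=
        avgState_diag_congr hd n (by rw [e]; simp [mul_assoc])
      have hh : height (θ c d) x = height (θ c d) y + 1 := by
        rw [e, height_mul, height_mul, height_b_pow, height_a]; ring
      rw [avgState, LinearMap.smul_apply, LinearMap.sum_apply,
        Finset.sum_eq_single i hz (fun h => absurd (Finset.mem_range.2 hi) h), hi', ih, hh]
      simp only [Nat.cast_add, Nat.cast_one, add_le_add_iff_right, smul_eq_mul, mul_ite, mul_zero]
      rw [zpow_add_one₀ hd', mul_inv_rev]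

end BS

namespace BS

variable {c d : ℕ}

theorem hasJoins (hc : 0 < c) (hd : 0 < d) : HasJoins (P c d) :=
  fun x y h => exists_isJoin hc hd x.2 y.2 h

theorem exp_neg_mul_lt_one (hd : 0 < d) {β : ℝ} (hβ : Real.log d < β) :
    Real.exp (-β) * d < 1 := by
  have hd' : (0 : ℝ) < d := by exact_mod_cast hd
  calc Real.exp (-β) * d < Real.exp (-Real.log d) * d := by gcongr
    _ = 1 := by rw [Real.exp_neg, Real.exp_log hd', inv_mul_cancel₀ hd'.ne']

theorem log_nonneg (d : ℕ) : 0 ≤ Real.log d := Real.log_natCast_nonneg d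

/-! ### Existence of the canonical states -/

theorem exists_isCanonical (hc : 0 < c) (hd : 0 < d) {β : ℝ} (hβ : Real.log d < β) :
    ∃ φ : Toeplitz c d →ₗ[ℂ] ℂ, IsState φ ∧ IsCanonical (θ c d) (T c d) β φ := by
  set r : ℝ := Real.exp (-β) * d with hr
  have hr1 : r < 1 := exp_neg_mul_lt_one hd hβ
  have hd' : (d : ℝ) ≠ 0 := by exact_mod_cast hd.ne'
  have hr0 : 0 < r := by positivity
  have hgeom : HasSum (fun n => (1 - r) * r ^ n) 1 := by
    have := (hasSum_geometric_of_lt_one hr0.le hr1).mul_left (1 - r)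
    rwa [mul_inv_cancel₀ (by linarith)] at this
  obtain ⟨φ, hφ, hs⟩ := IsState.exists_hasSum (fun n => isState_avgState (c := c) hd n 1)
    (fun n => mul_nonneg (by linarith) (pow_nonneg hr0.le n)) hgeom
  refine ⟨φ, hφ, fun x => (hs _).unique ?_, fun x y hxy => (hs _).unique ?_⟩
  · obtain ⟨k, hk⟩ := Int.eq_ofNat_of_zero_le (height_nonneg_of_mem x.2)
    simp only [avgState_diag hc, hk, zpow_natCast, Nat.cast_le]
    -- Terms with `n < k` vanish, and the tail is `∑ (1 - r) r^{n+k} d^{-k} = r^k d^{-k} = e^{-βk}`.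
    rw [← hasSum_nat_add_iff' k, Finset.sum_eq_zero, sub_zero]
    · have h := Complex.hasSum_ofReal.2 (hgeom.mul_left (Real.exp (-β * k)))
      rw [mul_one] at h
      rw [Int.cast_natCast]
      convert h using 1
      · rfl
      funext n
      have hd'' : (d : ℂ) ≠ 0 := by exact_mod_cast hd.ne'
      rw [if_pos (by lia), mul_comm (-β) (k : ℝ), Real.exp_nat_mul, pow_add, hr]
      push_cast
      field_simp
      ring
    · intro i hi
      rw [if_neg (by simpa using hi), mul_zero]
  · simpa only [avgState_offDiag hd _ _ hxy, mul_zero] using hasSum_zero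

/-- At `β = ln d` the geometric weights degenerate, but the averages at a fixed monomial are
constant once `n ≥ θ(x)`, so any limit point will do. -/
theorem exists_isCanonical_log (hc : 0 < c) (hd : 0 < d) :
    ∃ φ : Toeplitz c d →ₗ[ℂ] ℂ, IsState φ ∧ IsCanonical (θ c d) (T c d) (Real.log d) φ := by
  have hd' : (0 : ℝ) < d := by exact_mod_cast hd
  obtain ⟨φ, hφ, ht⟩ := IsState.exists_tendsto_hyperfilter
    (fun n => isState_avgState (c := c) hd n 1)
  refine ⟨φ, hφ, fun x => tendsto_nhds_unique (ht _) ?_, fun x y hxy =>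
    tendsto_nhds_unique (ht _) ?_⟩
  · obtain ⟨k, hk⟩ := Int.eq_ofNat_of_zero_le (height_nonneg_of_mem x.2)
    refine Filter.Tendsto.mono_left ?_ Nat.hyperfilter_le_atTop
    refine tendsto_const_nhds.congr' ?_
    filter_upwards [Filter.eventually_ge_atTop k] with n hn
    rw [avgState_diag hc, if_pos (by rw [hk]; exact_mod_cast hn), hk, zpow_natCast,
      neg_mul, Real.exp_neg, mul_comm, Int.cast_natCast, Real.exp_nat_mul, Real.exp_log hd']
    push_cast
    rfl
  · simpa only [avgState_offDiag hd _ _ hxy] using tendsto_const_nhds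

/-! ### Haar measure -/

theorem moment_haar (n : ℤ) :
    moment AddCircle.haarAddCircle n = if n = 0 then 1 else 0 := by
  have h := congrFun (fourierCoeff_fourier (T := 1) n) 0
  simp only [fourierCoeff, neg_zero, fourier_zero, one_smul] at h
  rw [moment, h, Pi.single_apply]
  simp only [eq_comm]

theorem momentValue_haar_zero (hd : 0 < d) {β : ℝ} (hβ : Real.log d < β) :
    momentValue c d β AddCircle.haarAddCircle 0 = 1 := by
  set r : ℝ := Real.exp (-β) * d with hr
  have hr1 : r < 1 := exp_neg_mul_lt_one hd hβ
  have hr0 : 0 ≤ r := by positivity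
  have hs : HasSum (fun k : ℕ => if 1 ≤ k ∧ ∀ j < k, d ^ (j + 1) ∣ c ^ j * 0 then
      (Real.exp (-β * k) * d ^ k : ℂ) *
        moment AddCircle.haarAddCircle ((c ^ k * 0 / d ^ k : ℕ) : ℤ) else 0)
      (((1 - r)⁻¹ - 1 : ℝ) : ℂ) := by
    rw [← hasSum_nat_add_iff' 1]
    have h := Complex.hasSum_ofReal.2 ((hasSum_nat_add_iff' 1).2
      (hasSum_geometric_of_lt_one hr0 hr1))
    rw [Finset.sum_range_one, pow_zero] at h
    rw [Finset.sum_range_one, if_neg (by simp), sub_zero]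
    convert h using 1
    · rfl
    funext k
    rw [if_pos ⟨by lia, by simp⟩, moment_haar, if_pos (by simp), mul_one, mul_comm (-β),
      Real.exp_nat_mul, hr]
    push_cast
    ring
  rw [momentValue, hs.tsum_eq, moment_haar, if_pos (by simp)]
  have h1 : (1 - r) * (1 + ((1 - r)⁻¹ - 1)) = 1 := by
    rw [add_sub_cancel, mul_inv_cancel₀ (by linarith)]
  have := congrArg (fun x : ℝ => (x : ℂ)) h1
  push_cast [hr] at this ⊢
  exact this

/-- Divisibility at `j = k - 1` makes every exponent `c^k t / d^k` in the sum positive, and Haar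
measure has no nonzero moments there. -/
theorem momentValue_haar_pos (hc : 0 < c) (hd : 0 < d) (β : ℝ) {t : ℕ} (ht : 0 < t) :
    momentValue c d β AddCircle.haarAddCircle t = 0 := by
  rw [momentValue, moment_haar, if_neg (by exact_mod_cast ht.ne'), zero_add]
  rw [(tsum_congr fun k => ?_ : _ = ∑' _ : ℕ, (0 : ℂ)), tsum_zero, mul_zero]
  refine ite_eq_right_iff.2 fun ⟨hk, h⟩ => ?_
  have h1 : d ^ k ≤ c ^ k * t := by
    obtain ⟨j, rfl⟩ : ∃ j, k = j + 1 := ⟨k - 1, by lia⟩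
    calc d ^ (j + 1) ≤ c ^ j * t := Nat.le_of_dvd (by positivity) (h j (by lia))
      _ ≤ c ^ (j + 1) * t := by gcongr; lia
  have h2 : 0 < c ^ k * t / d ^ k := Nat.div_pos h1 (by positivity)
  rw [moment_haar, if_neg (by exact_mod_cast h2.ne'), mul_zero]

/-! ### The values of KMS states -/

section KMS

variable {A : Type*} [CStarAlgebra A] {S : P c d →* A} {α : ℝ → A ≃⋆ₐ[ℂ] A} {β : ℝ}
  {φ : A →ₗ[ℂ] ℂ}

theorem apply_mul_of_isKMS (hα : ∀ t x, α t (S x) = phase (θ c d) t x • S x) (h : IsKMS α β φ)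
    (x : P c d) (a : A) : φ (S x * a) = Real.exp (-β * height (θ c d) x) * φ (a * S x) :=
  h.mul_comm_of_homogeneous (fun t => hα t x) a

theorem apply_star_mul_of_isKMS (hα : ∀ t x, α t (S x) = phase (θ c d) t x • S x)
    (h : IsKMS α β φ) (x : P c d) (a : A) :
    φ (star (S x) * a) = Real.exp (β * height (θ c d) x) * φ (a * star (S x)) := by
  have := h.mul_comm_of_homogeneous (b := star (S x)) (m := -height (θ c d) x) (fun t => ?_) a
  · rw [this]
    push_cast
    rw [neg_mul_neg]
  · rw [map_star, hα, star_smul]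
    congr 1
    simp only [phase, Complex.star_def, ← Complex.exp_conj]
    congr 1
    simp

/-- A KMS state that vanishes at the powers of `b` is canonical. -/
theorem isCanonical_of_isKMS (hc : 0 < c) (hd : 0 < d) (hS : IsNicaCovariant (P c d) S)
    (hα : ∀ t x, α t (S x) = phase (θ c d) t x • S x) (hβ : β ≠ 0) (h : IsKMS α β φ)
    (hb : ∀ t : ℕ, 0 < t → φ (S (bP c d ^ t)) = 0) : IsCanonical (θ c d) S β φ where
  diag x := by
    rw [apply_mul_of_isKMS hα h, hS.isometry, h.state.map_one, mul_one]
  offDiag x y hxy := by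
    have h1 := apply_mul_of_isKMS hα h x (star (S y))
    by_cases hh : height (θ c d) x = height (θ c d) y
    · rw [h1]
      refine mul_eq_zero_of_right _ ?_
      by_cases hj : JoinFinite (P c d) (y : Grp c d) x
      · obtain ⟨k, hk, hy, hx⟩ := hj
        have hQ := inv_mul_mem_Q hc hd y.2 x.2 (P_le_Q hy) (P_le_Q hx) (by simp) hh.ge
        obtain ⟨m, hm⟩ := exists_b_zpow_of_height_eq_zero hd hQ
          (by rw [height_mul, height_inv, hh]; ring)
        -- At equal heights `y⁻¹ x` is a power of `b`, so `S_y^* S_x` is `S_{b^n}` or its adjoint.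
        rcases Int.eq_nat_or_neg m with ⟨n, rfl | rfl⟩
        · obtain rfl : x = y * bP c d ^ n :=
            Subtype.ext (by simpa [inv_mul_eq_iff_eq_mul, bP] using hm)
          rw [hS.star_mul_mul]
          refine hb n (Nat.pos_of_ne_zero fun h0 => hxy ?_)
          rw [h0, pow_zero, mul_one]
        · obtain rfl : y = x * bP c d ^ n := Subtype.ext (by
            have := congrArg (fun g => y * g * b c d ^ n) hm
            simpa [mul_assoc, bP] using this.symm)
          rw [← star_star (S x), ← star_mul, h.state.map_star, hS.star_mul_mul, hb n, star_zero]
          refine Nat.pos_of_ne_zero fun h0 => hxy ?_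
          rw [h0, pow_zero, mul_one]
      · rw [hS.star_mul_of_not_joinFinite hj, map_zero]
    -- Cycling both factors returns the same value times `e^{β(θ(y) - θ(x))}`, which is not `1`
    -- because `β ≠ 0`.
    · rw [apply_star_mul_of_isKMS hα h, ← mul_assoc, ← Complex.ofReal_mul, ← Real.exp_add] at h1
      have h2 : Real.exp (-β * height (θ c d) x + β * height (θ c d) y) ≠ 1 := by
        rw [Ne, Real.exp_eq_one_iff]
        intro h0
        have : β * ((height (θ c d) y : ℝ) - height (θ c d) x) = 0 := by linarith
        rcases mul_eq_zero.1 this with h3 | h3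
        · exact hβ h3
        · exact hh (by exact_mod_cast (sub_eq_zero.1 h3).symm)
      by_contra h0
      exact h2 (by exact_mod_cast (mul_eq_right₀ h0).1 h1.symm)

theorem beta_eq_log_of_isKMS (hS : IsNicaCovariant (P c d) S)
    (hsum : ∑ j ∈ Finset.range d, S (bP c d ^ j * aP c d) * star (S (bP c d ^ j * aP c d)) = 1)
    (hα : ∀ t x, α t (S x) = phase (θ c d) t x • S x) (h : IsKMS α β φ) : β = Real.log d := by
  have h1 := congrArg φ hsum
  have hh : ∀ j : ℕ, height (θ c d) (bP c d ^ j * aP c d : P c d) = 1 := fun j => by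
    rw [Submonoid.coe_mul, height_mul]
    simp [bP, aP]
  simp only [map_sum, apply_mul_of_isKMS hα h, hS.isometry, h.state.map_one, hh, Int.cast_one,
    mul_one, Finset.sum_const, Finset.card_range, nsmul_eq_mul] at h1
  have h2 : (d : ℝ) * Real.exp (-β) = 1 := by exact_mod_cast h1
  have h3 : (d : ℝ) = Real.exp β := by
    rw [Real.exp_neg] at h2
    field_simp at h2
    exact h2
  rw [h3, Real.log_exp]

theorem not_joinFinite_of_not_dvd (hc : 0 < c) (hd : 0 < d) {j t : ℕ} (ht : ¬ d ∣ t) :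
    ¬ JoinFinite (P c d) ((bP c d ^ j * aP c d : P c d) : Grp c d)
      (bP c d ^ t * (bP c d ^ j * aP c d) : P c d) := by
  rintro ⟨k, hk, h1, h2⟩
  refine ht ?_
  have := dvd_sub_of_mul_eq hc hd (m := j) (n := t + j) (P_le_Q h1) (P_le_Q h2) (by
    simp [bP, aP, zpow_add, mul_assoc])
  rw [add_sub_cancel_right] at this
  exact_mod_cast this

/-- With `s_j = S_{b^j a}`, inserting `∑ s_j s_j^* = 1` and cycling gives `φ(S_{b^t}) = ∑ e^{-β}
φ(s_j^* S_{b^t} s_j)`. For `d ∤ t` the ranges of `s_j` and `S_{b^t} s_j` are orthogonal; for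
exponent `dt` each compression is `S_{b^{ct}}`, and `d e^{-β} = 1`. -/
theorem apply_b_pow_of_isKMS (hc : 0 < c) (hd : 0 < d) (hS : IsNicaCovariant (P c d) S)
    (hsum : ∑ j ∈ Finset.range d, S (bP c d ^ j * aP c d) * star (S (bP c d ^ j * aP c d)) = 1)
    (hα : ∀ t x, α t (S x) = phase (θ c d) t x • S x) (h : IsKMS α β φ) (t : ℕ) :
    (¬ d ∣ t → φ (S (bP c d ^ t)) = 0) ∧
      φ (S (bP c d ^ (d * t))) = φ (S (bP c d ^ (c * t))) := by
  have key : ∀ t, φ (S (bP c d ^ t)) = ∑ j ∈ Finset.range d, Real.exp (-β) *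
      φ (star (S (bP c d ^ j * aP c d)) * S (bP c d ^ t * (bP c d ^ j * aP c d))) := fun t => by
    calc φ (S (bP c d ^ t)) = φ (S (bP c d ^ t) * ∑ j ∈ Finset.range d,
          S (bP c d ^ j * aP c d) * star (S (bP c d ^ j * aP c d))) := by rw [hsum, mul_one]
      _ = _ := by
        rw [Finset.mul_sum, map_sum]
        refine Finset.sum_congr rfl fun j _ => ?_
        have hh : height (θ c d) (bP c d ^ t * (bP c d ^ j * aP c d) : P c d) = 1 := by
          rw [Submonoid.coe_mul, height_mul, Submonoid.coe_mul, height_mul]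
          simp [bP, aP]
        rw [← mul_assoc, ← map_mul, apply_mul_of_isKMS hα h, hh, Int.cast_one, mul_one]
  refine ⟨fun ht => ?_, ?_⟩
  · rw [key]
    refine Finset.sum_eq_zero fun j _ => ?_
    rw [hS.star_mul_of_not_joinFinite (not_joinFinite_of_not_dvd hc hd ht), map_zero, mul_zero]
  · have e : ∀ j, bP c d ^ (d * t) * (bP c d ^ j * aP c d) =
        bP c d ^ j * aP c d * bP c d ^ (c * t) := fun j => by
      refine Subtype.ext ?_
      have := b_pow_mul_a (c := c) (d := d) t
      change b c d ^ (d * t) * (b c d ^ j * a c d) = b c d ^ j * a c d * b c d ^ (c * t)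
      rw [mul_assoc, ← this, ← mul_assoc, ← mul_assoc, ← pow_add, ← pow_add, add_comm]
    have hd1 : (d : ℂ) * Real.exp (-β) = 1 := by
      have hd' : (0 : ℝ) < d := by exact_mod_cast hd
      rw [beta_eq_log_of_isKMS hS hsum hα h, Real.exp_neg, Real.exp_log hd']
      exact_mod_cast mul_inv_cancel₀ hd'.ne'
    simp only [key (d * t), e, hS.star_mul_mul, Finset.sum_const, Finset.card_range, nsmul_eq_mul]
    rw [← mul_assoc, hd1, one_mul]

theorem apply_b_pow_eq_zero_of_isKMS (hc : 0 < c) (hd : 0 < d) (hdc : ¬ d ∣ c)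
    (hS : IsNicaCovariant (P c d) S)
    (hsum : ∑ j ∈ Finset.range d, S (bP c d ^ j * aP c d) * star (S (bP c d ^ j * aP c d)) = 1)
    (hα : ∀ t x, α t (S x) = phase (θ c d) t x • S x) (h : IsKMS α β φ) (t : ℕ) (ht : 0 < t) :
    φ (S (bP c d ^ t)) = 0 := by
  -- Replacing `ds` by `cs` strictly lowers the valuation at this prime, so the descent ends at an
  -- exponent not divisible by `d`.
  obtain ⟨p, hp⟩ : ∃ p, c.factorization p < d.factorization p := by
    by_contra! hle
    exact hdc ((Nat.factorization_le_iff_dvd hd.ne' hc.ne').1 hle)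
  induction hn : t.factorization p using Nat.strong_induction_on generalizing t with
  | _ n ih =>
    by_cases hdt : d ∣ t
    · obtain ⟨s, rfl⟩ := hdt
      have hs : 0 < s := Nat.pos_of_mul_pos_left ht
      rw [(apply_b_pow_of_isKMS hc hd hS hsum hα h s).2]
      refine ih _ ?_ (c * s) (by positivity) rfl
      rw [← hn, Nat.factorization_mul hc.ne' hs.ne', Nat.factorization_mul hd.ne' hs.ne']
      simpa using hp
    · exact (apply_b_pow_of_isKMS hc hd hS hsum hα h t).1 hdt

end KMS

/-! ### The quotient -/

theorem star_defect_mul_defect (hc : 0 < c) (hd : 0 < d) :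
    star (defect c d) * defect c d = defect c d := by
  have hT := NicaAlg.T_cov (P c d)
  set e : ℕ → Toeplitz c d := fun j =>
    T c d (bP c d ^ j * aP c d) * star (T c d (bP c d ^ j * aP c d)) with he
  have hdef : defect c d = 1 - ∑ j ∈ Finset.range d, e j := rfl
  have hstar : ∀ j, star (e j) = e j := fun j => by simp [he]
  have hmul : ∀ i < d, ∀ j < d, e i * e j = if i = j then e i else 0 := by
    intro i hi j hj
    split_ifs with hij
    · subst hij
      simp only [he]
      rw [mul_assoc, ← mul_assoc (star _), hT.isometry, one_mul]
    · refine hT.disjoint _ _ ?_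
      rintro ⟨k, hk, h1, h2⟩
      refine hij (eq_of_mul_eq hc hd hi hj (P_le_Q h1) (P_le_Q h2) ?_).1
      simp [bP, aP, mul_assoc]
  have hsq : (∑ j ∈ Finset.range d, e j) * ∑ j ∈ Finset.range d, e j =
      ∑ j ∈ Finset.range d, e j := by
    rw [Finset.sum_mul_sum]
    refine Finset.sum_congr rfl fun i hi => ?_
    rw [Finset.sum_congr rfl fun j hj => hmul i (Finset.mem_range.1 hi) j (Finset.mem_range.1 hj),
      Finset.sum_ite_eq, if_pos hi]
  rw [hdef, star_sub, star_one, star_sum, Finset.sum_congr rfl fun j _ => hstar j, mul_sub, sub_mul,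
    one_mul, mul_one, sub_mul, one_mul, hsq]
  abel

theorem apply_defect (hd : 0 < d) {φ : Toeplitz c d →ₗ[ℂ] ℂ} (hφ : IsState φ)
    (h : IsCanonical (θ c d) (T c d) (Real.log d) φ) : φ (defect c d) = 0 := by
  have hd' : (0 : ℝ) < d := by exact_mod_cast hd
  have hh : ∀ j : ℕ, height (θ c d) (bP c d ^ j * aP c d : P c d) = 1 := fun j => by
    rw [Submonoid.coe_mul, height_mul]
    simp [bP, aP]
  rw [defect, map_sub, map_sum, hφ.map_one]
  simp only [h.diag, hh, Int.cast_one, mul_one, Finset.sum_const, Finset.card_range, nsmul_eq_mul]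
  rw [Real.exp_neg, Real.exp_log hd', sub_eq_zero]
  exact_mod_cast (mul_inv_cancel₀ hd'.ne').symm

variable (c d) in
/-- The representation `x ↦ T̄_x`. -/
noncomputable def TbarHom : P c d →* Cuntz c d := (q c d : Toeplitz c d →* Cuntz c d).comp (T c d)

theorem TbarHom_apply (x : P c d) : TbarHom c d x = q c d (T c d x) := rfl

theorem TbarHom_cov : IsNicaCovariant (P c d) (TbarHom c d) where
  isometry x := by
    simp only [TbarHom_apply, ← map_star, ← map_mul, (NicaAlg.T_cov (P c d)).isometry, map_one]
  join x y z h := by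
    simp only [TbarHom_apply, ← map_star, ← map_mul, (NicaAlg.T_cov (P c d)).join x y z h]
  disjoint x y h := by
    simp only [TbarHom_apply, ← map_star, ← map_mul, (NicaAlg.T_cov (P c d)).disjoint x y h,
      map_zero]

theorem αbar_TbarHom (t : ℝ) (x : P c d) :
    αbar c d t (TbarHom c d x) = phase (θ c d) t x • TbarHom c d x := by
  rw [TbarHom_apply, αbar_q, gaugeAut_T, map_smul]

theorem sum_TbarHom : ∑ j ∈ Finset.range d,
    TbarHom c d (bP c d ^ j * aP c d) * star (TbarHom c d (bP c d ^ j * aP c d)) = 1 := by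
  have h : q c d (defect c d) = 0 := Ideal.Quotient.eq_zero_iff_mem.2 (mem_closedIdeal _)
  change q c d (1 - ∑ j ∈ Finset.range d, _) = 0 at h
  rw [map_sub, map_one, sub_eq_zero, map_sum] at h
  rw [h]
  simp only [map_mul, map_star, TbarHom_apply]

theorem q_surjective : Function.Surjective (q c d) := Ideal.Quotient.mk_surjective

theorem dense_span_TbarHom (hc : 0 < c) (hd : 0 < d) :
    Dense (Submodule.span ℂ (monomials (TbarHom c d)) : Set (Cuntz c d)) := by
  have hcont : Continuous (q c d) :=
    AddMonoidHomClass.continuous_of_bound (q c d) 1 fun a => by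
      rw [one_mul]; exact NonUnitalStarAlgHom.norm_apply_le _ a
  refine (q_surjective.denseRange.dense_image hcont (NicaAlg.dense_span (hasJoins hc hd))).mono ?_
  rintro _ ⟨x, hx, rfl⟩
  have hle : Submodule.span ℂ (monomials (T c d)) ≤
      (Submodule.span ℂ (monomials (TbarHom c d))).comap
        (q c d : Toeplitz c d →ₐ[ℂ] Cuntz c d).toLinearMap := by
    rw [Submodule.span_le]
    rintro _ ⟨x, y, rfl⟩
    refine Submodule.subset_span ⟨x, y, ?_⟩
    change q c d _ = _
    rw [map_mul, map_star]
    rfl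
  exact hle hx

theorem exists_canonical_quotient (hc : 0 < c) (hd : 0 < d) :
    ∃ ψ : Cuntz c d →ₗ[ℂ] ℂ, IsState ψ ∧ IsCanonical (θ c d) (TbarHom c d) (Real.log d) ψ := by
  obtain ⟨φ, hφ, hcan⟩ := exists_isCanonical_log hc hd
  have hT := NicaAlg.T_cov (P c d)
  have hP := hasJoins hc hd
  have hD := NicaAlg.dense_span hP
  obtain ⟨ψ, hψ, hq⟩ := exists_state_quotient hφ fun x hx =>
    eq_zero_of_mem_closedIdeal hφ hD (by
      rintro _ ⟨x, y, rfl⟩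
      refine ⟨Real.exp (-(Real.log d * (height (θ c d) x - height (θ c d) y : ℤ))), fun a => ?_⟩
      have := mul_eq_of_dense hφ hD (b := T c d x * star (T c d y)) (by
        rintro _ ⟨u, v, rfl⟩
        exact hcan.mul_comm_monomial hT hP (fun x => height_nonneg_of_mem x.2) u v x y) a
      rw [this, ← mul_assoc, ← Complex.ofReal_mul, ← Real.exp_add, neg_add_cancel, Real.exp_zero,
        Complex.ofReal_one, one_mul]) (star_defect_mul_defect hc hd) (apply_defect hd hφ hcan) hx
  have hval : ∀ x y, ψ (TbarHom c d x * star (TbarHom c d y)) = φ (T c d x * star (T c d y)) :=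
    fun x y => hq _
  exact ⟨ψ, hψ, fun x => by rw [hval, hcan.diag], fun x y h => by rw [hval, hcan.offDiag x y h]⟩

/-- Existence, uniqueness and limits of `ψ_{β,Haar}` thereby become statements about canonical
states. Here `β > ln d ≥ 0` supplies `β ≠ 0`. -/
theorem isPsi_iff (hc : 0 < c) (hd : 0 < d) {β : ℝ} (hβ : Real.log d < β)
    {φ : Toeplitz c d →ₗ[ℂ] ℂ} : IsPsi c d β AddCircle.haarAddCircle φ ↔
      IsState φ ∧ IsCanonical (θ c d) (T c d) β φ := by
  have hT := NicaAlg.T_cov (P c d)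
  have hP := hasJoins hc hd
  constructor
  · intro h
    refine ⟨h.kms.state, isCanonical_of_isKMS hc hd hT (gaugeAut_T (θ c d))
      ((log_nonneg d).trans_lt hβ).ne' h.kms fun t ht => ?_⟩
    rw [h.value, momentValue_haar_pos hc hd β ht]
  · rintro ⟨hφ, hcan⟩
    refine ⟨hcan.isKMS hT hP (fun x => height_nonneg_of_mem x.2) hφ (NicaAlg.dense_span hP)
      (gaugeAut_T (θ c d)), fun t => ?_⟩
    rcases Nat.eq_zero_or_pos t with rfl | ht
    · rw [pow_zero, map_one, hφ.map_one, momentValue_haar_zero hd hβ]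
    · rw [momentValue_haar_pos hc hd β ht]
      have := hcan.offDiag (bP c d ^ t) 1 fun h =>
        b_pow_ne_one hc hd ht (congrArg Subtype.val h)
      simpa using this

end BS

/-! ### The main theorem -/

theorem proposition6p1 (c d : ℕ) (hc : 0 < c) (hd : 0 < d) :
    ∃ ψ : BS.Cuntz c d →ₗ[ℂ] ℂ,
      IsKMS (BS.αbar c d) (Real.log d) ψ ∧
      (∀ x y : BS.P c d,
        (x = y → ψ (BS.Tbar c d x * star (BS.Tbar c d y)) =
          Real.exp (-Real.log d * height (BS.θ c d) x)) ∧
        (x ≠ y → ψ (BS.Tbar c d x * star (BS.Tbar c d y)) = 0)) ∧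
      (∀ β : ℝ, Real.log d < β →
        ∃! φ : BS.Toeplitz c d →ₗ[ℂ] ℂ, BS.IsPsi c d β AddCircle.haarAddCircle φ) ∧
      (∀ (β : ℕ → ℝ) (φ : ℕ → BS.Toeplitz c d →ₗ[ℂ] ℂ),
        (∀ n, Real.log d < β n) →
        Filter.Tendsto β Filter.atTop (nhds (Real.log d)) →
        (∀ n, BS.IsPsi c d (β n) AddCircle.haarAddCircle (φ n)) →
        ∀ a : BS.Toeplitz c d,
          Filter.Tendsto (fun n => φ n a) Filter.atTop (nhds (ψ (BS.q c d a)))) ∧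
      (¬ d ∣ c → ∀ (β : ℝ) (φ : BS.Cuntz c d →ₗ[ℂ] ℂ),
        IsKMS (BS.αbar c d) β φ → β = Real.log d ∧ φ = ψ) := by
  obtain ⟨ψ, hψ, hcan⟩ := BS.exists_canonical_quotient hc hd
  have hP := BS.hasJoins hc hd
  have hDq := BS.dense_span_TbarHom hc hd
  have hD := NicaAlg.dense_span hP
  refine ⟨ψ, hcan.isKMS BS.TbarHom_cov hP (fun x => BS.height_nonneg_of_mem x.2) hψ hDq
    BS.αbar_TbarHom, fun x y => ⟨?_, hcan.offDiag x y⟩, fun β hβ => ?_,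
    fun β φ hβ hlim hφ => ?_, fun hdc β φ hφ => ?_⟩
  · rintro rfl
    exact hcan.diag x
  · obtain ⟨φ, hφ⟩ := BS.exists_isCanonical hc hd hβ
    refine ⟨φ, (BS.isPsi_iff hc hd hβ).2 hφ, fun φ' hφ' => ?_⟩
    obtain ⟨h1, h2⟩ := (BS.isPsi_iff hc hd hβ).1 hφ'
    exact h2.ext h1 hφ.1 hD hφ.2
  · have hφ' := fun n => (BS.isPsi_iff hc hd (hβ n)).1 (hφ n)
    let ψq : BS.Toeplitz c d →ₗ[ℂ] ℂ :=
      ψ ∘ₗ (BS.q c d : BS.Toeplitz c d →ₐ[ℂ] BS.Cuntz c d).toLinearMap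
    have hψq : IsState ψq := by
      refine ⟨(congrArg ψ (map_one (BS.q c d))).trans hψ.map_one, fun a => ?_⟩
      refine (hψ.nonneg (BS.q c d a)).trans_eq (congrArg ψ ?_)
      rw [← map_star, ← map_mul]
      rfl
    refine IsState.tendsto_of_dense (ψ := ψq) (fun n => (hφ' n).1) hψq hD ?_
    rintro _ ⟨x, y, rfl⟩
    have e : ψq (BS.T c d x * star (BS.T c d y)) =
        ψ (BS.TbarHom c d x * star (BS.TbarHom c d y)) := rfl
    by_cases hxy : x = y
    · subst hxy
      have h1 : Continuous fun s : ℝ => ((Real.exp (-s * height (BS.θ c d) x) : ℝ) : ℂ) := by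
        fun_prop
      rw [e, hcan.diag]
      simpa only [(hφ' _).2.diag, Function.comp_def] using (h1.tendsto _).comp hlim
    · rw [e, hcan.offDiag x y hxy]
      simpa only [(hφ' _).2.offDiag x y hxy] using tendsto_const_nhds
  · have hβ := BS.beta_eq_log_of_isKMS BS.TbarHom_cov BS.sum_TbarHom BS.αbar_TbarHom hφ
    subst hβ
    -- `d ∤ c` excludes `d = 1`, so the inverse temperature `ln d` is nonzero and monomials of
    -- unequal heights are killed.
    have hd1 : 1 < d := by
      by_contra h
      exact hdc (by rw [show d = 1 by lia]; exact one_dvd c)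
    have hlog : Real.log d ≠ 0 := (Real.log_pos (by exact_mod_cast hd1)).ne'
    refine ⟨rfl, IsCanonical.ext ?_ hφ.state hψ hDq hcan⟩
    exact BS.isCanonical_of_isKMS hc hd BS.TbarHom_cov BS.αbar_TbarHom hlog hφ
      (BS.apply_b_pow_eq_zero_of_isKMS hc hd hdc BS.TbarHom_cov BS.sum_TbarHom BS.αbar_TbarHom hφ)
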